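/- Let $d\ge 1$ be an integer, $\mathcal S=\{s\in[0,1]^d:\|s\|_1\le 1\}$ with $\|s\|_1=\sum_{i=1}^d|s_i|$, and let $f:\mathcal S\to[0,\infty)$ be a probability density (with respect to Lebesgue measure) that is twice continuously differentiable on $\mathcal S$ (up to the boundary). Let $X_1,X_2,\dots$ be i.i.d. random vectors with density $f$. For $\alpha\in(0,\infty)^d$ and $\beta>0$ let $$K_{\alpha,\beta}(x)=\frac{\Gamma(\|\alpha\|_1+\beta)}{\Gamma(\beta)\prod_{i=1}^d\Gamma(\alpha_i)}\,(1-\|x\|_1)^{\beta-1}\prod_{i=1}^d x_i^{\alpha_i-1},\qquad x\in\mathcal S,$$ be the $\mathrm{Dirichlet}(\alpha,\beta)$ density, and for $n\ge1$, $b>0$ let $$\hat f_{n,b}(s)=\frac1n\sum_{k=1}^n K_{s/b+1,\,(1-\|s\|_1)/b+1}(X_k),\quad s\in\mathcal S,\qquad \mathrm{MISE}[\hat f_{n,b}]=\int_{\mathcal S}\mathbb E\big[|\hat f_{n,b}(s)-f(s)|^2\big]\,ds$$ (where $s/b+1=(s_1/b+1,\dots,s_d/b+1)$). Put $\psi(s)=\big[(4\pi)^d(1-\|s\|_1)\prod_{i=1}^d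 s_i\big]^{-1/2}$, $$g(s)=\sum_{i=1}^d(1-(d+1)s_i)\,\partial_i f(s)+\frac12\sum_{i,j=1}^d s_i(\mathbf 1_{\{i=j\}}-s_j)\,\partial_i\partial_j f(s),$$ $A=\int_{\mathcal S}\psi(s)f(s)\,ds$ and $B=\int_{\mathcal S}g(s)^2\,ds$. Then all these integrals and expectations are finite, and the following hold. (a) As $n\to\infty$ and $b\to0$ (with $b>0$), $$\mathrm{MISE}[\hat f_{n,b}]=n^{-1}b^{-d/2}A+b^2B+o(n^{-1}b^{-d/2})+o(b^2).$$ (b) Suppose $B>0$, and put $$b_{\mathrm{opt}}(n)=n^{-2/(d+4)}\Big[\frac d4\cdot\frac AB\Big]^{2/(d+4)}.$$ For each $n\ge1$, $b_{\mathrm{opt}}(n)$ is positive and is the unique minimizer over $b>0$ of the leading part $n^{-1}b^{-d/2}A+b^2B$. It is the asymptotically optimal bandwidth with respect to $\mathrm{MISE}$: for every sequence $b(n)$ that is eventually positive and tends to $0$, and every $\varepsilon>0$, one has $\mathrm{MISE}[\hat f_{n,b_{\mathrm{opt}}(n)}]\le(1+\varepsilon)\,\mathrm{MISE}[\hat f_{n,b(n)}]$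 for all large $n$; and if $\mathrm{MISE}[\hat f_{n,b(n)}]\sim\mathrm{MISE}[\hat f_{n,b_{\mathrm{opt}}(n)}]$, then $b(n)\sim b_{\mathrm{opt}}(n)$. Moreover, as $n\to\infty$, $$\mathrm{MISE}[\hat f_{n,b_{\mathrm{opt}}(n)}]=n^{-4/(d+4)}\left[\frac{1+\frac d4}{(\frac d4)^{d/(d+4)}}\right]\frac{A^{4/(d+4)}}{B^{-d/(d+4)}}+o(n^{-4/(d+4)}).$$ (c) If $n^{2/(d+4)}\,b(n)\to\lambda$ for some $\lambda>0$, then, as $n\to\infty$, $$\mathrm{MISE}[\hat f_{n,b(n)}]=n^{-4/(d+4)}\big[\lambda^{-d/2}A+\lambda^2B\big]+o(n^{-4/(d+4)}).$$ -/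

import Mathlib

open MeasureTheory ProbabilityTheory Filter Topology Asymptotics

noncomputable section

namespace DirichletKernel

/-- The `ℓ¹` norm on `ℝ^d`. -/
def l1 {d : ℕ} (s : Fin d → ℝ) : ℝ := ∑ i, |s i|

/-- The `d`-dimensional (full, closed) simplex `{s ∈ [0,1]^d : ‖s‖₁ ≤ 1}`. -/
def simplex (d : ℕ) : Set (Fin d → ℝ) :=
  {s | (∀ i, s i ∈ Set.Icc (0 : ℝ) 1) ∧ l1 s ≤ 1}

/-- The density of the `Dirichlet(α, β)` distribution on the simplex. -/
def dirichletDensity {d : ℕ} (α : Fin d → ℝ) (β : ℝ) (s : Fin d → ℝ) : ℝ :=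
  Real.Gamma (l1 α + β) / (Real.Gamma β * ∏ i, Real.Gamma (α i)) *
    ((1 - l1 s) ^ (β - 1) * ∏ i, s i ^ (α i - 1))

/-- The Dirichlet kernel estimator at the point `s`, with bandwidth `b`,
computed from the observations `x 0, …, x (n - 1)`. -/
def estimator {d : ℕ} (n : ℕ) (b : ℝ) (x : ℕ → Fin d → ℝ) (s : Fin d → ℝ) : ℝ :=
  (1 / (n : ℝ)) * ∑ k ∈ Finset.range n,
    dirichletDensity (fun i => s i / b + 1) ((1 - l1 s) / b + 1) (x k)

/-- The mean squared error `E[|f̂_{n,b}(s) - f(s)|²]` of the estimator at `s`. -/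
def mse {d : ℕ} {Ω : Type*} [MeasurableSpace Ω] (P : Measure Ω) (X : ℕ → Ω → Fin d → ℝ)
    (f : (Fin d → ℝ) → ℝ) (n : ℕ) (b : ℝ) (s : Fin d → ℝ) : ℝ :=
  ∫ ω, |estimator n b (fun k => X k ω) s - f s| ^ 2 ∂P

/-- The mean integrated squared error of the estimator. -/
def mise {d : ℕ} {Ω : Type*} [MeasurableSpace Ω] (P : Measure Ω) (X : ℕ → Ω → Fin d → ℝ)
    (f : (Fin d → ℝ) → ℝ) (n : ℕ) (b : ℝ) : ℝ :=
  ∫ s in simplex d, mse P X f n b s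

/-- The `i`-th partial derivative on the simplex (the ordinary one at interior points, and the
one determined by the values of the function on the simplex at boundary points). -/
def pderiv {d : ℕ} (i : Fin d) (f : (Fin d → ℝ) → ℝ) (s : Fin d → ℝ) : ℝ :=
  fderivWithin ℝ f (simplex d) s (Pi.single i 1)

/-- The first order coefficient of the bias. -/
def biasCoeff {d : ℕ} (f : (Fin d → ℝ) → ℝ) (s : Fin d → ℝ) : ℝ :=
  ∑ i, (1 - ((d : ℝ) + 1) * s i) * pderiv i f s +
    (1 / 2) * ∑ i, ∑ j, s i * ((if i = j then 1 else 0) - s j) * pderiv i (pderiv j f) s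

/-- `ψ(s) = [(4π)^d (1 - ‖s‖₁) ∏ i, s i]^{-1/2}`. -/
def psi {d : ℕ} (s : Fin d → ℝ) : ℝ :=
  ((4 * Real.pi) ^ d * (1 - l1 s) * ∏ i, s i) ^ (-(1 / 2) : ℝ)

/-- The leading part `n⁻¹ b^{-d/2} A + b² B` of the mean integrated squared error. -/
def leading (d : ℕ) (A B : ℝ) (n : ℕ) (b : ℝ) : ℝ :=
  (n : ℝ)⁻¹ * b ^ (-((d : ℝ) / 2)) * A + b ^ 2 * B

/-- The bandwidth `n^{-2/(d+4)} [(d/4) (A/B)]^{2/(d+4)}`. -/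
def optBandwidth (d : ℕ) (A B : ℝ) (n : ℕ) : ℝ :=
  (n : ℝ) ^ (-(2 / ((d : ℝ) + 4))) * (((d : ℝ) / 4) * (A / B)) ^ (2 / ((d : ℝ) + 4))

/-- A bandwidth sequence: eventually positive, and tending to `0`. -/
def IsBandwidth (b : ℕ → ℝ) : Prop :=
  (∀ᶠ n in atTop, 0 < b n) ∧ Tendsto b atTop (𝓝 0)

/-- The bandwidth sequence `β` is asymptotically optimal for the criterion `M n b` (to be made
small): no bandwidth sequence does better than `β` by a factor that stays away from `1`,
and every bandwidth sequence that does as well as `β` is asymptotically equivalent to `β`. -/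
def IsAsymptoticallyOptimal (M : ℕ → ℝ → ℝ) (β : ℕ → ℝ) : Prop :=
  IsBandwidth β ∧
  ∀ b : ℕ → ℝ, IsBandwidth b →
    (∀ ε : ℝ, 0 < ε → ∀ᶠ n in atTop, M n (β n) ≤ (1 + ε) * M n (b n)) ∧
    ((fun n => M n (b n)) ~[atTop] (fun n => M n (β n)) → b ~[atTop] β)

end DirichletKernel

end

/-! ### Dirichlet integrals over simplices -/

namespace DirichletKernel

/-! The kernel at `s` is itself a probability density, that of `kernelMeasure s b`, so the mean of
the estimator at `s` is an average of `f` under a Dirichlet law. For i.i.d. data the mean squared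
error splits exactly into n⁻¹ (second moment - squared mean) plus squared bias (`mse_eq`,
`mise_eq`). What remains is two limits as b → 0 that do not involve n, so no relation between n and
b is needed.

Bias. Multiplying a Dirichlet density by a coordinate raises one parameter by one, which makes all
moments explicit: the mean displacement and the second moments about `s` are of order b, with the
coefficients that appear in g, and the fourth moments are O(b²). A Taylor expansion with remainder
ε|z-s|² + C|z-s|⁴ then gives bias/b → g(s) (`tendsto_bias_div`). The Lipschitz gradient gives a
uniform bound Cb (`exists_abs_bias_le`), and dominated convergence produces b²B.

Variance. Squaring the kernel doubles its exponents, so the square is a constant times the kernel of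
bandwidth b/2 (`dirichletDensity_sq`). Legendre duplication turns that constant into a product of
ratios Γ(x+1/2)/Γ(x+1), which log-convexity of Γ traps between (x+1/2)^(-1/2) and x^(-1/2). After
multiplication by b^(d/2) the constant tends to ψ(s) and is at most `psiFactor d b` times ψ(s),
where `psiFactor d b` tends to 1. Since ψ is proportional to a Dirichlet density with all parameters
1/2, it is integrable, and dominated convergence produces A. The squared mean is bounded, hence
negligible because d ≥ 1.

Bandwidth. With b = t b_opt the leading part is b_opt² B ((4/d) t^(-d/2) + t²), which exceeds its
value at t = 1 by at least a multiple of log² t (`quadratic_growth`). Along every bandwidth sequence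
the error is equivalent to its leading part (`HasExpansion.tendsto_div_leading`); this yields
optimality, and the log² t term forces any equally good sequence to be equivalent to b_opt. The
optimal value is the case of (c) in which λ is the constant of b_opt. -/

theorem lintegral_scaled_beta {α β c : ℝ} (hα : 0 < α) (hβ : 0 < β) (hc : 0 < c) :
    ∫⁻ x in Set.Icc 0 c, ENNReal.ofReal (x ^ (α - 1) * (c - x) ^ (β - 1)) =
      ENNReal.ofReal (c ^ (α + β - 1) * (Real.Gamma α * Real.Gamma β / Real.Gamma (α + β))) := by
  -- The null endpoints are dropped to match `betaPDF`, which vanishes off the open unit interval; x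
  -- = ct then reduces the claim to its total mass being one.
  rw [← restrict_Ioo_eq_restrict_Icc, ← lintegral_indicator measurableSet_Ioo]
  have hmap := Real.smul_map_volume_mul_left hc.ne'
  conv_lhs => rw [← hmap]
  have hmeas : Measurable ((Set.Ioo 0 c).indicator
      fun x => ENNReal.ofReal (x ^ (α - 1) * (c - x) ^ (β - 1))) :=
    Measurable.indicator (by fun_prop) measurableSet_Ioo
  rw [lintegral_smul_measure, lintegral_map hmeas (by fun_prop)]
  have hbp : 0 < beta α β := beta_pos hα hβ
  have key : ∀ t : ℝ, (Set.Ioo 0 c).indicator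
      (fun x => ENNReal.ofReal (x ^ (α - 1) * (c - x) ^ (β - 1))) (c * t) =
      ENNReal.ofReal (c ^ (α + β - 2) * beta α β) * betaPDF α β t := by
    intro t
    rw [betaPDF_eq]
    by_cases ht : 0 < t ∧ t < 1
    · have hm : c * t ∈ Set.Ioo 0 c := ⟨mul_pos hc ht.1, by nlinarith [ht.2]⟩
      rw [Set.indicator_of_mem hm, if_pos ht, ← ENNReal.ofReal_mul (by positivity)]
      congr 1
      have h1 : c - c * t = c * (1 - t) := by ring
      rw [h1, Real.mul_rpow hc.le ht.1.le, Real.mul_rpow hc.le (by linarith [ht.2])]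
      have h2 : c ^ (α + β - 2) = c ^ (α - 1) * c ^ (β - 1) := by
        rw [← Real.rpow_add hc]; ring_nf
      rw [h2]; field_simp
    · have hm : c * t ∉ Set.Ioo 0 c := by
        rintro ⟨h1, h2⟩
        exact ht ⟨pos_of_mul_pos_right h1 hc.le, by nlinarith⟩
      rw [Set.indicator_of_notMem hm, if_neg ht]; simp
  simp_rw [key]
  rw [lintegral_const_mul' _ _ ENNReal.ofReal_ne_top, lintegral_betaPDF_eq_one hα hβ, mul_one,
    smul_eq_mul, ← ENNReal.ofReal_mul (abs_nonneg _), abs_of_pos hc, ← mul_assoc]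
  congr 2
  conv_lhs => rw [← Real.rpow_one c]
  rw [Real.rpow_one, mul_comm, ← Real.rpow_add_one hc.ne']; ring_nf

/-- The closed simplex of size `c`. -/
def scaledSimplex (d : ℕ) (c : ℝ) : Set (Fin d → ℝ) := {y | (∀ i, 0 ≤ y i) ∧ ∑ i, y i ≤ c}

theorem measurableSet_scaledSimplex (d : ℕ) (c : ℝ) : MeasurableSet (scaledSimplex d c) := by
  have h : scaledSimplex d c =
      (⋂ i, {y : Fin d → ℝ | 0 ≤ y i}) ∩ {y : Fin d → ℝ | ∑ i, y i ≤ c} := by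
    ext y; simp [scaledSimplex]
  rw [h]
  refine (MeasurableSet.iInter fun i => ?_).inter ?_
  · exact measurableSet_le measurable_const (measurable_pi_apply i)
  · exact measurableSet_le (by fun_prop) measurable_const

/-- Fixing the first coordinate x leaves a simplex of size c - x, whose integral is a power of c - x
by induction; the integral over x is then a beta integral. The general size c is what makes the
induction close. -/
theorem lintegral_scaledSimplex {d : ℕ} (α : Fin d → ℝ) {β : ℝ} (hα : ∀ i, 0 < α i)
    (hβ : 0 < β) {c : ℝ} (hc : 0 < c) :
    ∫⁻ y in scaledSimplex d c,
        ENNReal.ofReal ((∏ i, y i ^ (α i - 1)) * (c - ∑ i, y i) ^ (β - 1)) =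
      ENNReal.ofReal (c ^ (∑ i, α i + β - 1) *
        ((∏ i, Real.Gamma (α i)) * Real.Gamma β / Real.Gamma (∑ i, α i + β))) := by
  induction d generalizing c with
  | zero =>
    have h0 : scaledSimplex 0 c = Set.univ := by
      ext y; simp [scaledSimplex, hc.le]
    have := (Real.Gamma_pos_of_pos hβ).ne'
    simp [h0, this, volume_pi]
  | succ d ih =>
    have hmp := (volume_preserving_piFinSuccAbove (fun _ : Fin (d + 1) => ℝ) 0).symm
    rw [← lintegral_indicator (measurableSet_scaledSimplex _ _),
      ← hmp.lintegral_comp_emb (MeasurableEquiv.measurableEmbedding _)]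
    have hmeas : Measurable ((scaledSimplex (d + 1) c).indicator fun y =>
        ENNReal.ofReal ((∏ i, y i ^ (α i - 1)) * (c - ∑ i, y i) ^ (β - 1))) :=
      Measurable.indicator (by fun_prop) (measurableSet_scaledSimplex _ _)
    rw [Measure.volume_eq_prod, lintegral_prod (fun a => (scaledSimplex (d + 1) c).indicator
        (fun y => ENNReal.ofReal ((∏ i, y i ^ (α i - 1)) * (c - ∑ i, y i) ^ (β - 1)))
        ((MeasurableEquiv.piFinSuccAbove (fun _ : Fin (d + 1) => ℝ) 0).symm a))
        (hmeas.comp (MeasurableEquiv.measurable _)).aemeasurable]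
    set a' : Fin d → ℝ := fun i => α i.succ with ha'
    have hsum : ∑ i, α i = α 0 + ∑ i, a' i := Fin.sum_univ_succ _
    have hpos : 0 < ∑ i, a' i + β := by
      have : 0 ≤ ∑ i, a' i := Finset.sum_nonneg fun i _ => (hα _).le
      linarith
    set K : ℝ := (∏ i, Real.Gamma (a' i)) * Real.Gamma β / Real.Gamma (∑ i, a' i + β) with hK
    have hK0 : 0 ≤ K := by
      have := Real.Gamma_pos_of_pos hpos
      have := Real.Gamma_pos_of_pos hβ
      have : 0 ≤ ∏ i, Real.Gamma (a' i) :=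
        Finset.prod_nonneg fun i _ => (Real.Gamma_pos_of_pos (hα _)).le
      positivity
    -- At x = c the slice has size 0, outside the induction hypothesis; a single point does not
    -- affect the integral.
    have inner : ∀ x : ℝ, x ≠ c → (∫⁻ y : Fin d → ℝ, (scaledSimplex (d + 1) c).indicator
        (fun y => ENNReal.ofReal ((∏ i, y i ^ (α i - 1)) * (c - ∑ i, y i) ^ (β - 1)))
        ((MeasurableEquiv.piFinSuccAbove (fun _ : Fin (d + 1) => ℝ) 0).symm (x, y))) =
        (Set.Icc 0 c).indicator (fun x => ENNReal.ofReal K *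
          ENNReal.ofReal (x ^ (α 0 - 1) * (c - x) ^ (∑ i, a' i + β - 1))) x := by
      intro x hxc
      have hcons : ∀ y : Fin d → ℝ,
          (MeasurableEquiv.piFinSuccAbove (fun _ : Fin (d + 1) => ℝ) 0).symm (x, y) =
            (Fin.cons x y : Fin (d + 1) → ℝ) := by
        intro y; simp [MeasurableEquiv.piFinSuccAbove, Fin.consEquiv]
      simp_rw [hcons]
      by_cases hx : x ∈ Set.Icc 0 c
      · have hcx : 0 < c - x := sub_pos.2 (lt_of_le_of_ne hx.2 hxc)
        rw [Set.indicator_of_mem hx]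
        have h1 : ∀ y : Fin d → ℝ, (scaledSimplex (d + 1) c).indicator
            (fun y => ENNReal.ofReal ((∏ i, y i ^ (α i - 1)) * (c - ∑ i, y i) ^ (β - 1)))
            (Fin.cons x y : Fin (d + 1) → ℝ) =
            ENNReal.ofReal (x ^ (α 0 - 1)) * (scaledSimplex d (c - x)).indicator
            (fun y => ENNReal.ofReal ((∏ i, y i ^ (a' i - 1)) *
              (c - x - ∑ i, y i) ^ (β - 1))) y := by
          intro y
          have hiff : (Fin.cons x y : Fin (d + 1) → ℝ) ∈ scaledSimplex (d + 1) c ↔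
              y ∈ scaledSimplex d (c - x) := by
            simp only [scaledSimplex, Set.mem_ofPred_eq, Fin.forall_fin_succ, Fin.cons_zero,
              Fin.cons_succ, Fin.sum_univ_succ, hx.1, true_and]
            exact and_congr_right fun _ => ⟨fun h => by linarith, fun h => by linarith⟩
          by_cases hy : y ∈ scaledSimplex d (c - x)
          · rw [Set.indicator_of_mem (hiff.2 hy), Set.indicator_of_mem hy,
              ← ENNReal.ofReal_mul (Real.rpow_nonneg hx.1 _)]
            simp only [Fin.prod_univ_succ, Fin.sum_univ_succ, Fin.cons_zero, Fin.cons_succ, ha']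
            rw [sub_add_eq_sub_sub, mul_assoc]
          · rw [Set.indicator_of_notMem (fun h => hy (hiff.1 h)), Set.indicator_of_notMem hy,
              mul_zero]
        simp_rw [h1]
        rw [lintegral_const_mul' _ _ ENNReal.ofReal_ne_top,
          lintegral_indicator (measurableSet_scaledSimplex _ _),
          ih a' (fun i => hα _) hcx, ← ENNReal.ofReal_mul (Real.rpow_nonneg hx.1 _),
          ← ENNReal.ofReal_mul hK0]
        congr 1; ring
      · rw [Set.indicator_of_notMem hx]
        have h1 : ∀ y : Fin d → ℝ,
            (Fin.cons x y : Fin (d + 1) → ℝ) ∉ scaledSimplex (d + 1) c := by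
          rintro y ⟨h1, h2⟩
          refine hx ⟨h1 0, ?_⟩
          rw [Fin.sum_univ_succ] at h2
          have : 0 ≤ ∑ i : Fin d, (Fin.cons x y : Fin (d + 1) → ℝ) i.succ :=
            Finset.sum_nonneg fun i _ => h1 _
          simp only [Fin.cons_zero] at h2
          linarith
        simp [Set.indicator_of_notMem (h1 _)]
    have hae : ∀ᵐ x : ℝ, x ≠ c := by simp [ae_iff]
    rw [lintegral_congr_ae (hae.mono inner), lintegral_indicator measurableSet_Icc,
      lintegral_const_mul' _ _ ENNReal.ofReal_ne_top, lintegral_scaled_beta (hα 0) hpos hc,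
      ← ENNReal.ofReal_mul hK0, hsum, Fin.prod_univ_succ, hK]
    congr 1
    have := (Real.Gamma_pos_of_pos hpos).ne'
    rw [add_assoc]
    field_simp
    rw [mul_comm (Real.Gamma (α 0))]

end DirichletKernel

/-! ### The simplex, the Dirichlet law and its moments -/

namespace DirichletKernel

variable {d : ℕ}

theorem simplex_eq_scaledSimplex : simplex d = scaledSimplex d 1 := by
  ext s
  refine ⟨fun h => ⟨fun i => (h.1 i).1, ?_⟩, fun h => ?_⟩
  · have := h.2
    rwa [l1, Finset.sum_congr rfl fun i _ => abs_of_nonneg (h.1 i).1] at this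
  · have h1 : l1 s ≤ 1 := by
      rw [l1, Finset.sum_congr rfl fun i _ => abs_of_nonneg (h.1 i)]; exact h.2
    refine ⟨fun i => ⟨h.1 i, ?_⟩, h1⟩
    exact (Finset.single_le_sum (fun j _ => h.1 j) (Finset.mem_univ i)).trans h.2

theorem measurableSet_simplex : MeasurableSet (simplex d) := by
  rw [simplex_eq_scaledSimplex]; exact measurableSet_scaledSimplex d 1

theorem l1_eq_sum {s : Fin d → ℝ} (hs : ∀ i, 0 ≤ s i) : l1 s = ∑ i, s i :=
  Finset.sum_congr rfl fun i _ => abs_of_nonneg (hs i)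

theorem simplex_nonneg {s : Fin d → ℝ} (hs : s ∈ simplex d) (i : Fin d) : 0 ≤ s i := (hs.1 i).1

theorem simplex_le_one {s : Fin d → ℝ} (hs : s ∈ simplex d) (i : Fin d) : s i ≤ 1 := (hs.1 i).2

theorem l1_simplex {s : Fin d → ℝ} (hs : s ∈ simplex d) : l1 s = ∑ i, s i :=
  l1_eq_sum (simplex_nonneg hs)

theorem l1_le_one {s : Fin d → ℝ} (hs : s ∈ simplex d) : l1 s ≤ 1 := hs.2

theorem isCompact_simplex : IsCompact (simplex d) := by
  have h : simplex d = Set.pi Set.univ (fun _ => Set.Icc (0 : ℝ) 1) ∩ {s | l1 s ≤ 1} := by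
    ext s; simp [simplex, Pi.le_def, forall_and]
  rw [h]
  refine (isCompact_univ_pi fun _ => isCompact_Icc).inter_right ?_
  exact isClosed_le (by unfold l1; fun_prop) continuous_const

theorem convex_simplex : Convex ℝ (simplex d) := by
  rw [simplex_eq_scaledSimplex]
  intro x hx y hy a b ha hb hab
  refine ⟨fun i => ?_, ?_⟩
  · have := hx.1 i
    have := hy.1 i
    simp only [Pi.add_apply, Pi.smul_apply, smul_eq_mul]
    positivity
  · simp only [Pi.add_apply, Pi.smul_apply, smul_eq_mul, Finset.sum_add_distrib,
      ← Finset.mul_sum]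
    nlinarith [mul_le_mul_of_nonneg_left hx.2 ha, mul_le_mul_of_nonneg_left hy.2 hb]

theorem volume_simplex_lt_top : volume (simplex d) < ⊤ := isCompact_simplex.measure_lt_top

theorem measurable_l1 : Measurable (l1 : (Fin d → ℝ) → ℝ) := by unfold l1; fun_prop

theorem measurable_dirichletDensity (α : Fin d → ℝ) (β : ℝ) :
    Measurable (dirichletDensity α β) := by
  have := measurable_l1 (d := d)
  unfold dirichletDensity
  fun_prop

theorem dirichletDensity_nonneg {α : Fin d → ℝ} {β : ℝ} (hα : ∀ i, 0 < α i) (hβ : 0 < β)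
    {x : Fin d → ℝ} (hx : x ∈ simplex d) : 0 ≤ dirichletDensity α β x := by
  have h1 : 0 < l1 α + β := by
    rw [l1_eq_sum fun i => (hα i).le]
    have : 0 ≤ ∑ i, α i := Finset.sum_nonneg fun i _ => (hα i).le
    linarith
  have := Real.Gamma_pos_of_pos h1
  have := Real.Gamma_pos_of_pos hβ
  have h2 : 0 < ∏ i, Real.Gamma (α i) := Finset.prod_pos fun i _ => Real.Gamma_pos_of_pos (hα i)
  have h3 : 0 ≤ ∏ i, x i ^ (α i - 1) :=
    Finset.prod_nonneg fun i _ => Real.rpow_nonneg (simplex_nonneg hx i) _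
  have h4 : 0 ≤ 1 - l1 x := by linarith [l1_le_one hx]
  unfold dirichletDensity
  positivity

theorem lintegral_dirichletDensity {α : Fin d → ℝ} {β : ℝ} (hα : ∀ i, 0 < α i) (hβ : 0 < β) :
    ∫⁻ x in simplex d, ENNReal.ofReal (dirichletDensity α β x) = 1 := by
  have h1 : 0 < ∑ i, α i + β := by
    have : 0 ≤ ∑ i, α i := Finset.sum_nonneg fun i _ => (hα i).le
    linarith
  have hg1 := Real.Gamma_pos_of_pos h1
  have hg2 := Real.Gamma_pos_of_pos hβ
  have hg3 : 0 < ∏ i, Real.Gamma (α i) := Finset.prod_pos fun i _ => Real.Gamma_pos_of_pos (hα i)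
  set K := Real.Gamma (∑ i, α i + β) / (Real.Gamma β * ∏ i, Real.Gamma (α i)) with hK
  have hK0 : 0 ≤ K := by positivity
  have h2 : ∀ x ∈ simplex d, ENNReal.ofReal (dirichletDensity α β x) = ENNReal.ofReal K *
      ENNReal.ofReal ((∏ i, x i ^ (α i - 1)) * (1 - ∑ i, x i) ^ (β - 1)) := by
    intro x hx
    rw [← ENNReal.ofReal_mul hK0, dirichletDensity, l1_simplex hx, l1_eq_sum fun i => (hα i).le,
      mul_comm (∏ i, x i ^ (α i - 1))]
  rw [setLIntegral_congr_fun measurableSet_simplex h2,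
    lintegral_const_mul' _ _ ENNReal.ofReal_ne_top, simplex_eq_scaledSimplex,
    lintegral_scaledSimplex α hα hβ one_pos, ← ENNReal.ofReal_mul hK0, Real.one_rpow, one_mul, hK]
  rw [← ENNReal.ofReal_one]
  congr 1
  field_simp

/-- The Dirichlet distribution on the simplex. -/
noncomputable def dirichletMeasure (α : Fin d → ℝ) (β : ℝ) : Measure (Fin d → ℝ) :=
  (volume.restrict (simplex d)).withDensity fun x => ENNReal.ofReal (dirichletDensity α β x)

theorem isProbabilityMeasure_dirichletMeasure {α : Fin d → ℝ} {β : ℝ} (hα : ∀ i, 0 < α i)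
    (hβ : 0 < β) : IsProbabilityMeasure (dirichletMeasure α β) :=
  ⟨by rw [dirichletMeasure, withDensity_apply _ MeasurableSet.univ, Measure.restrict_univ,
    lintegral_dirichletDensity hα hβ]⟩

theorem dirichletMeasure_absolutelyContinuous (α : Fin d → ℝ) (β : ℝ) :
    dirichletMeasure α β ≪ volume.restrict (simplex d) :=
  withDensity_absolutelyContinuous _ _

theorem ae_dirichletMeasure_mem_simplex (α : Fin d → ℝ) (β : ℝ) :
    ∀ᵐ x ∂(dirichletMeasure α β), x ∈ simplex d :=
  (dirichletMeasure_absolutelyContinuous α β).ae_le (ae_restrict_mem measurableSet_simplex)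

theorem integral_dirichletMeasure {α : Fin d → ℝ} {β : ℝ} (hα : ∀ i, 0 < α i)
    (hβ : 0 < β) (h : (Fin d → ℝ) → ℝ) :
    ∫ x, h x ∂(dirichletMeasure α β) = ∫ x in simplex d, dirichletDensity α β x * h x := by
  rw [dirichletMeasure, integral_withDensity_eq_integral_toReal_smul
    (measurable_dirichletDensity α β).ennreal_ofReal (ae_of_all _ fun _ => ENNReal.ofReal_lt_top)]
  refine setIntegral_congr_fun measurableSet_simplex fun x hx => ?_
  simp only [smul_eq_mul]
  rw [ENNReal.toReal_ofReal (dirichletDensity_nonneg hα hβ hx)]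

theorem exists_bound_of_continuousOn {h : (Fin d → ℝ) → ℝ} (hh : ContinuousOn h (simplex d)) :
    ∃ C, 0 ≤ C ∧ ∀ x ∈ simplex d, |h x| ≤ C := by
  obtain ⟨C, hC⟩ := isCompact_simplex.exists_bound_of_continuousOn hh
  exact ⟨max C 0, le_max_right _ _, fun x hx => (hC x hx).trans (le_max_left _ _)⟩

theorem integrable_dirichletMeasure {α : Fin d → ℝ} {β : ℝ} (hα : ∀ i, 0 < α i)
    (hβ : 0 < β) {h : (Fin d → ℝ) → ℝ} (hh : ContinuousOn h (simplex d)) :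
    Integrable h (dirichletMeasure α β) := by
  have := isProbabilityMeasure_dirichletMeasure hα hβ
  obtain ⟨C, -, hC⟩ := exists_bound_of_continuousOn hh
  refine Integrable.of_bound ((hh.aestronglyMeasurable measurableSet_simplex).mono_ac
    (dirichletMeasure_absolutelyContinuous α β)) C ?_
  filter_upwards [ae_dirichletMeasure_mem_simplex α β] with x hx using hC x hx

theorem sum_update_add_one (α : Fin d → ℝ) (i : Fin d) :
    ∑ j, Function.update α i (α i + 1) j = ∑ j, α j + 1 := by
  rw [Finset.sum_update_of_mem (Finset.mem_univ i),
    ← Finset.sum_erase_add _ _ (Finset.mem_univ i), Finset.sdiff_singleton_eq_erase]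
  ring

theorem update_add_one_pos {α : Fin d → ℝ} (hα : ∀ i, 0 < α i) (i j : Fin d) :
    0 < Function.update α i (α i + 1) j := by
  rw [Function.update_apply]
  split_ifs
  · linarith [hα i]
  · exact hα j

/-- Only Γ(z+1) = zΓ(z) is involved, for z = α_i and for the sum of all parameters. Every moment
below comes from iterating this shift. -/
theorem dirichletDensity_mul_coord {α : Fin d → ℝ} {β : ℝ} (hα : ∀ i, 0 < α i) (hβ : 0 < β)
    {x : Fin d → ℝ} (hx : x ∈ simplex d) (i : Fin d) :
    dirichletDensity α β x * x i = α i / (∑ j, α j + β) *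
      dirichletDensity (Function.update α i (α i + 1)) β x := by
  have h1 : 0 < ∑ i, α i + β := by
    have : 0 ≤ ∑ i, α i := Finset.sum_nonneg fun i _ => (hα i).le
    linarith
  have hg1 := (Real.Gamma_pos_of_pos h1).ne'
  have hg2 := (Real.Gamma_pos_of_pos hβ).ne'
  have hg0 := (Real.Gamma_pos_of_pos (hα i)).ne'
  have hai := (hα i).ne'
  rw [dirichletDensity, dirichletDensity, l1_eq_sum fun i => (hα i).le,
    l1_eq_sum fun j => (update_add_one_pos hα i j).le, sum_update_add_one]
  have e1 : ∀ F : Fin d → ℝ → ℝ, ∏ j, F j (Function.update α i (α i + 1) j) =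
      F i (α i + 1) * ∏ j ∈ Finset.univ.erase i, F j (α j) := by
    intro F
    rw [← Finset.mul_prod_erase _ _ (Finset.mem_univ i), Function.update_self]
    congr 1
    refine Finset.prod_congr rfl fun j hj => ?_
    rw [Function.update_of_ne (Finset.ne_of_mem_erase hj)]
  rw [e1 fun _ a => Real.Gamma a, e1 fun j a => x j ^ (a - 1),
    ← Finset.mul_prod_erase _ (fun j => Real.Gamma (α j)) (Finset.mem_univ i),
    ← Finset.mul_prod_erase _ (fun j => x j ^ (α j - 1)) (Finset.mem_univ i),
    show ∑ j, α j + 1 + β = ∑ j, α j + β + 1 by ring, Real.Gamma_add_one h1.ne',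
    Real.Gamma_add_one hai]
  have hg3 : ∏ j ∈ Finset.univ.erase i, Real.Gamma (α j) ≠ 0 :=
    Finset.prod_ne_zero_iff.2 fun j _ => (Real.Gamma_pos_of_pos (hα j)).ne'
  -- On the face x_i = 0 both sides vanish, the left one because α_i ≠ 0.
  have hxp : x i ^ (α i + 1 - 1) = x i ^ (α i - 1) * x i := by
    rcases (simplex_nonneg hx i).eq_or_lt with h | h
    · rw [← h, mul_zero, Real.zero_rpow (by linarith [hα i])]
    · rw [← Real.rpow_add_one h.ne']; ring_nf
  rw [hxp]
  field_simp

theorem integral_coord_mul {α : Fin d → ℝ} {β : ℝ} (hα : ∀ i, 0 < α i) (hβ : 0 < β)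
    (i : Fin d) (h : (Fin d → ℝ) → ℝ) :
    ∫ x, x i * h x ∂(dirichletMeasure α β) = α i / (∑ j, α j + β) *
      ∫ x, h x ∂(dirichletMeasure (Function.update α i (α i + 1)) β) := by
  rw [integral_dirichletMeasure hα hβ, integral_dirichletMeasure (update_add_one_pos hα i) hβ,
    ← integral_const_mul]
  refine setIntegral_congr_fun measurableSet_simplex fun x hx => ?_
  rw [← mul_assoc, dirichletDensity_mul_coord hα hβ hx, mul_assoc]

theorem integral_coord {α : Fin d → ℝ} {β : ℝ} (hα : ∀ i, 0 < α i) (hβ : 0 < β) (i : Fin d) :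
    ∫ x, x i ∂(dirichletMeasure α β) = α i / (∑ j, α j + β) := by
  have := isProbabilityMeasure_dirichletMeasure (update_add_one_pos hα i) hβ
  simpa using integral_coord_mul hα hβ i fun _ => 1

theorem integral_coord_mul_coord {α : Fin d → ℝ} {β : ℝ} (hα : ∀ i, 0 < α i) (hβ : 0 < β)
    (i j : Fin d) :
    ∫ x, x i * x j ∂(dirichletMeasure α β) = α i / (∑ j, α j + β) *
      ((α j + if i = j then 1 else 0) / (∑ j, α j + β + 1)) := by
  rw [integral_coord_mul hα hβ i fun x => x j, integral_coord (update_add_one_pos hα i) hβ,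
    sum_update_add_one, add_right_comm]
  congr 2
  rw [Function.update_apply]
  split_ifs with h1 h2 h2
  · rw [h1]
  · exact absurd h1.symm h2
  · exact absurd h2.symm h1
  · ring

theorem integral_coord_pow_succ {α : Fin d → ℝ} {β : ℝ} (hα : ∀ i, 0 < α i) (hβ : 0 < β)
    (i : Fin d) (k : ℕ) :
    ∫ x, x i ^ (k + 1) ∂(dirichletMeasure α β) = α i / (∑ j, α j + β) *
      ∫ x, x i ^ k ∂(dirichletMeasure (Function.update α i (α i + 1)) β) := by
  simp_rw [pow_succ']
  exact integral_coord_mul hα hβ i fun x => x i ^ k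

/-- Each factor x_i raises both α_i and the parameter total by one, so the moment is a ratio of
rising factorials. -/
theorem integral_coord_pow {α : Fin d → ℝ} {β : ℝ} (hα : ∀ i, 0 < α i) (hβ : 0 < β)
    (i : Fin d) (k : ℕ) :
    ∫ x, x i ^ k ∂(dirichletMeasure α β) =
      ∏ l ∈ Finset.range k, ((α i + l) / (∑ j, α j + β + l)) := by
  induction k generalizing α with
  | zero =>
    have := isProbabilityMeasure_dirichletMeasure hα hβ
    simp
  | succ k ih =>
    rw [integral_coord_pow_succ hα hβ, ih (update_add_one_pos hα i), sum_update_add_one,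
      Finset.prod_range_succ']
    rw [mul_comm]
    congr 1
    · refine Finset.prod_congr rfl fun l _ => ?_
      rw [Function.update_self]
      push_cast
      ring_nf
    · simp

end DirichletKernel

/-! ### Moments of the kernel about its base point -/

namespace DirichletKernel

variable {d : ℕ}

/-- The Dirichlet distribution whose density is the kernel of the estimator at `s`. -/
noncomputable def kernelMeasure (s : Fin d → ℝ) (b : ℝ) : Measure (Fin d → ℝ) :=
  dirichletMeasure (fun i => s i / b + 1) ((1 - l1 s) / b + 1)

theorem kernel_alpha_pos {s : Fin d → ℝ} (hs : s ∈ simplex d) {b : ℝ} (hb : 0 < b) (i : Fin d) :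
    0 < s i / b + 1 := by
  have := simplex_nonneg hs i
  positivity

theorem kernel_beta_pos {s : Fin d → ℝ} (hs : s ∈ simplex d) {b : ℝ} (hb : 0 < b) :
    0 < (1 - l1 s) / b + 1 := by
  have : 0 ≤ 1 - l1 s := by linarith [l1_le_one hs]
  positivity

theorem kernel_sum {s : Fin d → ℝ} (hs : s ∈ simplex d) {b : ℝ} (hb : 0 < b) :
    ∑ i, (s i / b + 1) + ((1 - l1 s) / b + 1) = (1 + (d + 1) * b) / b := by
  rw [Finset.sum_add_distrib, ← Finset.sum_div, l1_simplex hs]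
  simp
  field_simp
  ring

theorem isProbabilityMeasure_kernelMeasure {s : Fin d → ℝ} (hs : s ∈ simplex d) {b : ℝ}
    (hb : 0 < b) : IsProbabilityMeasure (kernelMeasure s b) :=
  isProbabilityMeasure_dirichletMeasure (kernel_alpha_pos hs hb) (kernel_beta_pos hs hb)

theorem integrable_kernelMeasure {s : Fin d → ℝ} (hs : s ∈ simplex d) {b : ℝ}
    (hb : 0 < b) {h : (Fin d → ℝ) → ℝ} (hh : ContinuousOn h (simplex d)) :
    Integrable h (kernelMeasure s b) :=
  integrable_dirichletMeasure (kernel_alpha_pos hs hb) (kernel_beta_pos hs hb) hh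

theorem integrable_kernelMeasure_of_continuous {s : Fin d → ℝ} (hs : s ∈ simplex d) {b : ℝ}
    (hb : 0 < b) {h : (Fin d → ℝ) → ℝ} (hh : Continuous h) :
    Integrable h (kernelMeasure s b) :=
  integrable_kernelMeasure hs hb hh.continuousOn

theorem ae_kernelMeasure_mem_simplex (s : Fin d → ℝ) (b : ℝ) :
    ∀ᵐ x ∂(kernelMeasure s b), x ∈ simplex d :=
  ae_dirichletMeasure_mem_simplex _ _

theorem kernelMeasure_integral_pow {s : Fin d → ℝ} (hs : s ∈ simplex d) {b : ℝ} (hb : 0 < b)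
    (i : Fin d) (k : ℕ) :
    ∫ x, x i ^ k ∂(kernelMeasure s b) =
      ∏ l ∈ Finset.range k, ((s i + (1 + l) * b) / (1 + (d + 1 + l) * b)) := by
  rw [kernelMeasure, integral_coord_pow (kernel_alpha_pos hs hb) (kernel_beta_pos hs hb),
    kernel_sum hs hb]
  refine Finset.prod_congr rfl fun l _ => ?_
  have : 1 + ((d : ℝ) + 1 + l) * b ≠ 0 := by positivity
  have : (1 + ((d : ℝ) + 1) * b) / b + l ≠ 0 := by positivity
  field_simp
  ring

theorem kernelMeasure_integral_coord {s : Fin d → ℝ} (hs : s ∈ simplex d) {b : ℝ} (hb : 0 < b)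
    (i : Fin d) :
    ∫ x, x i ∂(kernelMeasure s b) = (s i + b) / (1 + (d + 1) * b) := by
  simpa using kernelMeasure_integral_pow hs hb i 1

/-- Source of the first-order coefficients 1 - (d+1)s_i of the bias. -/
theorem kernelMeasure_integral_sub {s : Fin d → ℝ} (hs : s ∈ simplex d) {b : ℝ} (hb : 0 < b)
    (i : Fin d) :
    ∫ x, (x i - s i) ∂(kernelMeasure s b) = b * ((1 - (d + 1) * s i) / (1 + (d + 1) * b)) := by
  have := isProbabilityMeasure_kernelMeasure hs hb
  rw [integral_sub (integrable_kernelMeasure_of_continuous hs hb (by fun_prop))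
    (integrable_const _), kernelMeasure_integral_coord hs hb]
  simp
  field_simp
  ring

/-- Source of the second-order coefficients s_i(1_{i=j} - s_j); the other terms carry an extra
factor b. -/
theorem kernelMeasure_integral_sub_mul_sub {s : Fin d → ℝ} (hs : s ∈ simplex d) {b : ℝ}
    (hb : 0 < b) (i j : Fin d) :
    ∫ x, (x i - s i) * (x j - s j) ∂(kernelMeasure s b) =
      b * ((s i * ((if i = j then 1 else 0) - s j) + b * ((1 + if i = j then 1 else 0) -
        (d + 2) * (s i + s j) + (d + 1) * (d + 2) * (s i * s j))) /
        ((1 + (d + 1) * b) * (1 + (d + 2) * b))) := by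
  have := isProbabilityMeasure_kernelMeasure hs hb
  have h1 : ∀ x : Fin d → ℝ, (x i - s i) * (x j - s j) =
      (x i * x j - s i * x j - s j * x i) + s i * s j := fun x => by ring
  have hi : ∀ h : (Fin d → ℝ) → ℝ, Continuous h → Integrable h (kernelMeasure s b) :=
    fun h hh => integrable_kernelMeasure_of_continuous hs hb hh
  have h2 : ∫ x, x i * x j ∂(kernelMeasure s b) = _ :=
    integral_coord_mul_coord (kernel_alpha_pos hs hb) (kernel_beta_pos hs hb) i j
  simp_rw [h1]
  rw [integral_add (hi _ (by fun_prop)) (integrable_const _),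
    integral_sub (hi _ (by fun_prop)) (hi _ (by fun_prop)),
    integral_sub (hi _ (by fun_prop)) (hi _ (by fun_prop)), h2, integral_const_mul,
    integral_const_mul, kernelMeasure_integral_coord hs hb, kernelMeasure_integral_coord hs hb,
    kernel_sum hs hb]
  generalize (if i = j then (1 : ℝ) else 0) = e
  simp only [integral_const, probReal_univ, one_smul]
  have : 1 + ((d : ℝ) + 1) * b ≠ 0 := by positivity
  have : 1 + ((d : ℝ) + 2) * b ≠ 0 := by positivity
  have e1 : (1 + ((d : ℝ) + 1) * b) / b + 1 = (1 + ((d : ℝ) + 2) * b) / b := by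
    field_simp; ring
  rw [e1]
  field_simp
  ring

theorem kernelMeasure_integral_sub_pow_four {s : Fin d → ℝ} (hs : s ∈ simplex d) {b : ℝ}
    (hb : 0 < b) (i : Fin d) :
    ∫ x, (x i - s i) ^ 4 ∂(kernelMeasure s b) = ∫ x, x i ^ 4 ∂(kernelMeasure s b) -
      4 * s i * ∫ x, x i ^ 3 ∂(kernelMeasure s b) +
      6 * s i ^ 2 * ∫ x, x i ^ 2 ∂(kernelMeasure s b) -
      4 * s i ^ 3 * ∫ x, x i ∂(kernelMeasure s b) + s i ^ 4 := by
  have := isProbabilityMeasure_kernelMeasure hs hb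
  have h1 : ∀ x : Fin d → ℝ, (x i - s i) ^ 4 = x i ^ 4 - 4 * s i * x i ^ 3 +
      6 * s i ^ 2 * x i ^ 2 - 4 * s i ^ 3 * x i + s i ^ 4 := fun x => by ring
  simp_rw [h1]
  have hi : ∀ h : (Fin d → ℝ) → ℝ, Continuous h → Integrable h (kernelMeasure s b) :=
    fun h hh => integrable_kernelMeasure_of_continuous hs hb hh
  rw [integral_add (hi _ (by fun_prop)) (integrable_const _),
    integral_sub (hi _ (by fun_prop)) (hi _ (by fun_prop)),
    integral_add (hi _ (by fun_prop)) (hi _ (by fun_prop)),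
    integral_sub (hi _ (by fun_prop)) (hi _ (by fun_prop))]
  simp only [integral_const_mul, integral_const, probReal_univ, one_smul]

theorem exists_bound_on_unit_square {P : ℝ × ℝ → ℝ} (hP : Continuous P) :
    ∃ C, 0 ≤ C ∧ ∀ s ∈ Set.Icc (0 : ℝ) 1, ∀ b ∈ Set.Icc (0 : ℝ) 1, |P (s, b)| ≤ C := by
  obtain ⟨C, hC⟩ := (isCompact_Icc (a := (0 : ℝ)) (b := 1)).prod
    (isCompact_Icc (a := (0 : ℝ)) (b := 1)) |>.exists_bound_of_continuousOn hP.continuousOn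
  exact ⟨max C 0, le_max_right _ _, fun s hs b hb => (hC (s, b) ⟨hs, hb⟩).trans (le_max_left _ _)⟩

/-- This replaces a tail estimate: the order b² makes a quartic Taylor remainder negligible against
b. -/
theorem exists_kernelMeasure_integral_sub_pow_four_le (d : ℕ) :
    ∃ C, 0 ≤ C ∧ ∀ s ∈ simplex d, ∀ b ∈ Set.Ioc (0 : ℝ) 1, ∀ i,
      ∫ x, (x i - s i) ^ 4 ∂(kernelMeasure s b) ≤ C * b ^ 2 := by
  set D : ℝ := d + 1 with hD
  -- Over the common denominator the numerator is divisible by b², and P is the quotient as a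
  -- polynomial in (s_i, b). Its constant term in b is 3(s_i(1-s_i))², the Gaussian fourth moment.
  -- The denominator is at least 1 and can be discarded.
  obtain ⟨P, hP⟩ : ∃ P : ℝ × ℝ → ℝ, P = fun p =>
    3 * p.1 ^ 2 * (1 - p.1) ^ 2 + p.2 * (26 * p.1 - 72 * p.1 ^ 2 - 20 * p.1 ^ 2 * D +
      64 * p.1 ^ 3 + 42 * p.1 ^ 3 * D + 6 * p.1 ^ 3 * D ^ 2 - 18 * p.1 ^ 4 - 22 * p.1 ^ 4 * D -
      6 * p.1 ^ 4 * D ^ 2) + p.2 ^ 2 * (24 - 72 * p.1 - 24 * p.1 * D + 72 * p.1 ^ 2 +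
      60 * p.1 ^ 2 * D + 12 * p.1 ^ 2 * D ^ 2 - 24 * p.1 ^ 3 - 44 * p.1 ^ 3 * D -
      24 * p.1 ^ 3 * D ^ 2 - 4 * p.1 ^ 3 * D ^ 3 + 6 * p.1 ^ 4 * D + 11 * p.1 ^ 4 * D ^ 2 +
      6 * p.1 ^ 4 * D ^ 3 + p.1 ^ 4 * D ^ 4) := ⟨_, rfl⟩
  obtain ⟨C, hC0, hC⟩ := exists_bound_on_unit_square (P := P) (by rw [hP]; fun_prop)
  refine ⟨C, hC0, fun s hs b hb i => ?_⟩
  have hb0 := hb.1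
  have hD0 : 0 < D := by positivity
  have hden : 1 ≤ (1 + D * b) * (1 + (D + 1) * b) * (1 + (D + 2) * b) * (1 + (D + 3) * b) := by
    have h (k : ℝ) (hk : 0 ≤ k) : 1 ≤ 1 + (D + k) * b := by
      have : 0 ≤ (D + k) * b := by positivity
      linarith
    have h0 := h 0 le_rfl
    rw [add_zero] at h0
    exact one_le_mul_of_one_le_of_one_le (one_le_mul_of_one_le_of_one_le
      (one_le_mul_of_one_le_of_one_le h0 (h 1 (by norm_num))) (h 2 (by norm_num)))
      (h 3 (by norm_num))
  have key := (le_abs_self _).trans (hC (s i) (hs.1 i) b ⟨hb0.le, hb.2⟩)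
  rw [kernelMeasure_integral_sub_pow_four hs hb0, kernelMeasure_integral_coord hs hb0]
  simp only [kernelMeasure_integral_pow hs hb0, Finset.prod_range_succ, Finset.prod_range_zero,
    Nat.cast_zero, Nat.cast_one, Nat.cast_ofNat, one_mul, add_zero, ← hD]
  refine le_trans (le_of_eq (b := P (s i, b) * b ^ 2 / ((1 + D * b) * (1 + (D + 1) * b) *
    (1 + (D + 2) * b) * (1 + (D + 3) * b))) ?_) ?_
  · have h0 : 1 + D * b ≠ 0 := by positivity
    have h1 : 1 + (D + 1) * b ≠ 0 := by positivity
    have h2 : 1 + (D + 2) * b ≠ 0 := by positivity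
    have h3 : 1 + (D + 3) * b ≠ 0 := by positivity
    rw [hP]
    field_simp
    ring
  · rw [div_le_iff₀ (by positivity)]
    have h1 : P (s i, b) * b ^ 2 ≤ C * b ^ 2 := by gcongr
    exact h1.trans (le_mul_of_one_le_right (by positivity) hden)

end DirichletKernel

/-! ### Taylor estimates up to the boundary of a convex set -/

namespace DirichletKernel

section Taylor

variable {E : Type*} [NormedAddCommGroup E] [NormedSpace ℝ E] {S : Set E} {f : E → ℝ}
  {f' : E → E →L[ℝ] ℝ}

theorem segment_mem (hS : Convex ℝ S) {s z : E} (hs : s ∈ S) (hz : z ∈ S) {t : ℝ}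
    (ht : t ∈ Set.Icc (0 : ℝ) 1) : s + t • (z - s) ∈ S :=
  hS.add_smul_sub_mem hs hz ht

theorem hasDerivWithinAt_segment (hS : Convex ℝ S) (hf : ∀ x ∈ S, HasFDerivWithinAt f (f' x) S x)
    {s z : E} (hs : s ∈ S) (hz : z ∈ S) {t : ℝ} (ht : t ∈ Set.Icc (0 : ℝ) 1) :
    HasDerivWithinAt (fun t : ℝ => f (s + t • (z - s))) (f' (s + t • (z - s)) (z - s))
      (Set.Icc 0 1) t := by
  have h1 : HasDerivWithinAt (fun t : ℝ => s + t • (z - s)) (z - s) (Set.Icc 0 1) t := by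
    simpa using (((hasDerivAt_id t).smul_const (z - s)).const_add s).hasDerivWithinAt
  exact (hf _ (segment_mem hS hs hz ht)).comp_hasDerivWithinAt t h1
    fun u hu => segment_mem hS hs hz hu

/-- A Taylor estimate of order two along a segment, from an estimate of the derivative. -/
theorem abs_sub_taylor_le_of_segment (hS : Convex ℝ S)
    (hf : ∀ x ∈ S, HasFDerivWithinAt f (f' x) S x) {s z : E} (hs : s ∈ S) (hz : z ∈ S)
    {q C : ℝ} (hC : ∀ t ∈ Set.Icc (0 : ℝ) 1,
      |f' (s + t • (z - s)) (z - s) - f' s (z - s) - t * q| ≤ C) :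
    |f z - f s - f' s (z - s) - 1 / 2 * q| ≤ C := by
  -- Mean value inequality on [0,1] for the restriction of f to the segment minus its quadratic
  -- model; derivatives within `S` suffice, so boundary points are allowed.
  have h := norm_image_sub_le_of_norm_deriv_le_segment_01'
    (f := fun t : ℝ => f (s + t • (z - s)) - t * f' s (z - s) - t ^ 2 / 2 * q)
    (f' := fun t => f' (s + t • (z - s)) (z - s) - f' s (z - s) - t * q) (C := C)
    (fun t ht => by
      have h1 := hasDerivWithinAt_segment hS hf hs hz ht
      have h2 : HasDerivWithinAt (fun t : ℝ => t * f' s (z - s)) (f' s (z - s))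
          (Set.Icc 0 1) t := by
        simpa using ((hasDerivAt_id t).mul_const (f' s (z - s))).hasDerivWithinAt
      have h3 : HasDerivWithinAt (fun t : ℝ => t ^ 2 / 2 * q) (t * q) (Set.Icc 0 1) t := by
        have := ((((hasDerivAt_id t).pow 2).div_const 2).mul_const q).hasDerivWithinAt
          (s := Set.Icc 0 1)
        convert! this using 1
        simp
      exact (h1.sub h2).sub h3)
    (fun t ht => by
      rw [Real.norm_eq_abs]; exact hC t ⟨ht.1, ht.2.le⟩)
  rw [Real.norm_eq_abs] at h
  convert h using 2
  simp
  ring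

theorem abs_sub_taylor_one_le (hS : Convex ℝ S) (hf : ∀ x ∈ S, HasFDerivWithinAt f (f' x) S x)
    {L : ℝ} (hL : ∀ x ∈ S, ∀ y ∈ S, ‖f' x - f' y‖ ≤ L * ‖x - y‖) {s z : E} (hs : s ∈ S)
    (hz : z ∈ S) (hL0 : 0 ≤ L) : |f z - f s - f' s (z - s)| ≤ L * ‖z - s‖ ^ 2 := by
  have := abs_sub_taylor_le_of_segment hS hf hs hz (q := 0) (C := L * ‖z - s‖ ^ 2) fun t ht => by
    rw [mul_zero, sub_zero, ← sub_apply]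
    have h2 := hL _ (segment_mem hS hs hz ht) s hs
    rw [add_sub_cancel_left, norm_smul, Real.norm_eq_abs, abs_of_nonneg ht.1] at h2
    calc _ ≤ ‖f' (s + t • (z - s)) - f' s‖ * ‖z - s‖ := ContinuousLinearMap.le_opNorm _ _
      _ ≤ (L * (1 * ‖z - s‖)) * ‖z - s‖ := by
        gcongr
        refine h2.trans ?_
        gcongr
        exact ht.2
      _ = _ := by ring
  simpa using this

/-- A Peano remainder: the derivative map only needs to be differentiable at the one point s, and
the estimate is local. -/
theorem abs_sub_taylor_two_le (hS : Convex ℝ S) (hf : ∀ x ∈ S, HasFDerivWithinAt f (f' x) S x)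
    {s : E} (hs : s ∈ S) {f'' : E →L[ℝ] E →L[ℝ] ℝ} (hf' : HasFDerivWithinAt f' f'' S s)
    {ε : ℝ} (hε : 0 < ε) :
    ∃ δ > 0, ∀ z ∈ S, ‖z - s‖ < δ →
      |f z - f s - f' s (z - s) - 1 / 2 * f'' (z - s) (z - s)| ≤ ε * ‖z - s‖ ^ 2 := by
  have h1 := hf'.isLittleO.def hε
  rw [eventually_nhdsWithin_iff, Metric.eventually_nhds_iff] at h1
  obtain ⟨δ, hδ, h1⟩ := h1
  refine ⟨δ, hδ, fun z hz hzs => abs_sub_taylor_le_of_segment hS hf hs hz fun t ht => ?_⟩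
  have hn : ‖t • (z - s)‖ ≤ 1 * ‖z - s‖ := by
    rw [norm_smul, Real.norm_eq_abs, abs_of_nonneg ht.1]
    gcongr
    exact ht.2
  rw [one_mul] at hn
  have h2 := h1 (y := s + t • (z - s)) (by
    rw [dist_eq_norm, add_sub_cancel_left]; exact hn.trans_lt hzs) (segment_mem hS hs hz ht)
  rw [add_sub_cancel_left] at h2
  have h3 : f' (s + t • (z - s)) (z - s) - f' s (z - s) - t * f'' (z - s) (z - s) =
      (f' (s + t • (z - s)) - f' s - f'' (t • (z - s))) (z - s) := by
    simp
  rw [h3]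
  calc _ ≤ ‖f' (s + t • (z - s)) - f' s - f'' (t • (z - s))‖ * ‖z - s‖ :=
        ContinuousLinearMap.le_opNorm _ _
    _ ≤ (ε * ‖z - s‖) * ‖z - s‖ := by
        gcongr
        exact h2.trans (by gcongr)
    _ = _ := by ring

end Taylor

variable {d : ℕ} {f : (Fin d → ℝ) → ℝ}

theorem uniqueDiffOn_simplex : UniqueDiffOn ℝ (simplex d) := by
  refine uniqueDiffOn_convex convex_simplex ?_
  have ho : IsOpen {s : Fin d → ℝ | (∀ i, 0 < s i) ∧ ∑ i, s i < 1} := by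
    have : {s : Fin d → ℝ | (∀ i, 0 < s i) ∧ ∑ i, s i < 1} =
        (⋂ i, {s : Fin d → ℝ | 0 < s i}) ∩ {s : Fin d → ℝ | ∑ i, s i < 1} := by
      ext; simp
    rw [this]
    refine (isOpen_iInter_of_finite fun i => ?_).inter ?_
    · exact isOpen_lt continuous_const (continuous_apply i)
    · exact isOpen_lt (by fun_prop) continuous_const
  -- The barycentre, whose d+1 barycentric coordinates are all 1/(d+1) > 0.
  refine ⟨fun _ => 1 / ((d : ℝ) + 1), interior_maximal ?_ ho ⟨fun i => by positivity, ?_⟩⟩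
  · rw [simplex_eq_scaledSimplex]
    exact fun s hs => ⟨fun i => (hs.1 i).le, hs.2.le⟩
  · simp only [Finset.sum_const, Finset.card_univ, Fintype.card_fin, nsmul_eq_mul]
    rw [mul_one_div, div_lt_one (by positivity)]
    linarith

theorem contDiffOn_fderivWithin (hf : ContDiffOn ℝ 2 f (simplex d)) :
    ContDiffOn ℝ 1 (fderivWithin ℝ f (simplex d)) (simplex d) :=
  hf.fderivWithin uniqueDiffOn_simplex (by norm_num)

theorem hasFDerivWithinAt_simplex (hf : ContDiffOn ℝ 2 f (simplex d)) :
    ∀ x ∈ simplex d, HasFDerivWithinAt f (fderivWithin ℝ f (simplex d) x) (simplex d) x :=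
  fun x hx => ((hf.differentiableOn (by norm_num)) x hx).hasFDerivWithinAt

theorem hasFDerivWithinAt_fderivWithin_simplex (hf : ContDiffOn ℝ 2 f (simplex d)) :
    ∀ x ∈ simplex d, HasFDerivWithinAt (fderivWithin ℝ f (simplex d))
      (fderivWithin ℝ (fderivWithin ℝ f (simplex d)) (simplex d) x) (simplex d) x :=
  fun x hx => (((contDiffOn_fderivWithin hf).differentiableOn (by norm_num)) x hx).hasFDerivWithinAt

theorem contDiffOn_pderiv (hf : ContDiffOn ℝ 2 f (simplex d)) (i : Fin d) :
    ContDiffOn ℝ 1 (pderiv i f) (simplex d) :=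
  (contDiffOn_fderivWithin hf).clm_apply contDiffOn_const

theorem continuousOn_pderiv (hf : ContDiffOn ℝ 2 f (simplex d)) (i : Fin d) :
    ContinuousOn (pderiv i f) (simplex d) :=
  (contDiffOn_pderiv hf i).continuousOn

theorem continuousOn_pderiv_pderiv (hf : ContDiffOn ℝ 2 f (simplex d)) (i j : Fin d) :
    ContinuousOn (pderiv i (pderiv j f)) (simplex d) :=
  ((contDiffOn_pderiv hf j).continuousOn_fderivWithin uniqueDiffOn_simplex le_rfl).clm_apply
    continuousOn_const

theorem continuousOn_biasCoeff (hf : ContDiffOn ℝ 2 f (simplex d)) :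
    ContinuousOn (biasCoeff f) (simplex d) := by
  unfold biasCoeff
  refine ContinuousOn.add (continuousOn_finsetSum _ fun i _ => ?_)
    (continuousOn_const.mul (continuousOn_finsetSum _ fun i _ =>
      continuousOn_finsetSum _ fun j _ => ?_))
  · exact ContinuousOn.mul (by fun_prop) (continuousOn_pderiv hf i)
  · exact ContinuousOn.mul (by fun_prop) (continuousOn_pderiv_pderiv hf i j)

theorem fderivWithin_apply_eq_sum (s v : Fin d → ℝ) :
    fderivWithin ℝ f (simplex d) s v = ∑ i, v i * pderiv i f s := by
  conv_lhs => rw [pi_eq_sum_univ' v]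
  simp [pderiv, map_sum]

theorem pderiv_pderiv_eq (hf : ContDiffOn ℝ 2 f (simplex d)) {s : Fin d → ℝ} (hs : s ∈ simplex d)
    (i j : Fin d) : pderiv i (pderiv j f) s =
      fderivWithin ℝ (fderivWithin ℝ f (simplex d)) (simplex d) s (Pi.single i 1)
        (Pi.single j 1) := by
  have h := (hasFDerivWithinAt_fderivWithin_simplex hf s hs).clm_apply
    (hasFDerivWithinAt_const (Pi.single j (1 : ℝ)) s (simplex d))
  have h2 := h.fderivWithin (uniqueDiffOn_simplex s hs)
  unfold pderiv
  rw [h2]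
  simp

theorem fderivWithin_fderivWithin_apply_eq_sum (hf : ContDiffOn ℝ 2 f (simplex d))
    {s : Fin d → ℝ} (hs : s ∈ simplex d) (v : Fin d → ℝ) :
    fderivWithin ℝ (fderivWithin ℝ f (simplex d)) (simplex d) s v v =
      ∑ i, ∑ j, v i * v j * pderiv i (pderiv j f) s := by
  simp_rw [pderiv_pderiv_eq hf hs]
  conv_lhs => rw [pi_eq_sum_univ' v]
  simp only [map_sum, map_smul, sum_apply, smul_apply,
    smul_eq_mul, Finset.mul_sum]
  rw [Finset.sum_comm]
  refine Finset.sum_congr rfl fun i _ => Finset.sum_congr rfl fun j _ => ?_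
  ring

theorem norm_sq_le_sum_sq (v : Fin d → ℝ) : ‖v‖ ^ 2 ≤ ∑ i, v i ^ 2 := by
  have h0 : 0 ≤ ∑ i, v i ^ 2 := Finset.sum_nonneg fun i _ => sq_nonneg _
  have : ‖v‖ ≤ √(∑ i, v i ^ 2) := by
    refine (pi_norm_le_iff_of_nonneg (Real.sqrt_nonneg _)).2 fun i => ?_
    exact Real.abs_le_sqrt (Finset.single_le_sum (f := fun i => v i ^ 2)
      (fun j _ => sq_nonneg _) (Finset.mem_univ i))
  calc ‖v‖ ^ 2 ≤ √(∑ i, v i ^ 2) ^ 2 := by gcongr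
    _ = _ := Real.sq_sqrt h0

/-- Cauchy–Schwarz; it passes from the sup norm of the Taylor estimates to the coordinate moments,
which are explicit. -/
theorem norm_pow_four_le_sum_pow_four (v : Fin d → ℝ) : ‖v‖ ^ 4 ≤ d * ∑ i, v i ^ 4 := by
  calc ‖v‖ ^ 4 = (‖v‖ ^ 2) ^ 2 := by ring
    _ ≤ (∑ i, v i ^ 2) ^ 2 := by gcongr; exact norm_sq_le_sum_sq v
    _ ≤ _ := by
      have := sq_sum_le_card_mul_sum_sq (s := Finset.univ) (f := fun i => v i ^ 2)
      simpa [← pow_mul] using this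

theorem exists_lipschitz_fderivWithin (hf : ContDiffOn ℝ 2 f (simplex d)) :
    ∃ L, 0 ≤ L ∧ ∀ x ∈ simplex d, ∀ y ∈ simplex d,
      ‖fderivWithin ℝ f (simplex d) x - fderivWithin ℝ f (simplex d) y‖ ≤ L * ‖x - y‖ := by
  obtain ⟨L, hL⟩ := isCompact_simplex.exists_bound_of_continuousOn
    ((contDiffOn_fderivWithin hf).continuousOn_fderivWithin uniqueDiffOn_simplex le_rfl)
  refine ⟨max L 0, le_max_right _ _, fun x hx y hy => ?_⟩
  exact convex_simplex.norm_image_sub_le_of_norm_hasFDerivWithin_le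
    (hasFDerivWithinAt_fderivWithin_simplex hf)
    (fun z hz => (hL z hz).trans (le_max_left _ _)) hy hx

end DirichletKernel

/-! ### The bias: uniform bound and pointwise limit -/

namespace DirichletKernel

variable {d : ℕ} {f : (Fin d → ℝ) → ℝ}

theorem abs_kernelMeasure_integral_sub_le {s : Fin d → ℝ} (hs : s ∈ simplex d) {b : ℝ}
    (hb : 0 < b) (i : Fin d) : |∫ x, (x i - s i) ∂(kernelMeasure s b)| ≤ (d + 2) * b := by
  have h0 := simplex_nonneg hs i
  have h1 := simplex_le_one hs i
  rw [kernelMeasure_integral_sub hs hb, abs_mul, abs_of_pos hb, mul_comm]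
  gcongr
  rw [abs_div, abs_of_pos (by positivity : 0 < 1 + ((d : ℝ) + 1) * b)]
  refine (div_le_self (abs_nonneg _) ?_).trans (abs_le.2 ⟨?_, ?_⟩)
  · have : 0 ≤ ((d : ℝ) + 1) * b := by positivity
    linarith
  · nlinarith [Nat.cast_nonneg (α := ℝ) d]
  · nlinarith [Nat.cast_nonneg (α := ℝ) d]

theorem exists_kernelMeasure_integral_sub_sq_le (d : ℕ) :
    ∃ C, 0 ≤ C ∧ ∀ s ∈ simplex d, ∀ b ∈ Set.Ioc (0 : ℝ) 1, ∀ i,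
      ∫ x, (x i - s i) ^ 2 ∂(kernelMeasure s b) ≤ C * b := by
  obtain ⟨P, hP⟩ : ∃ P : ℝ × ℝ → ℝ, P = fun (p : ℝ × ℝ) => p.1 * (1 - p.1) +
    p.2 * (2 - (d + 2) * (p.1 + p.1) + (d + 1) * (d + 2) * (p.1 * p.1)) := ⟨_, rfl⟩
  obtain ⟨C, hC0, hC⟩ := exists_bound_on_unit_square (P := P) (by rw [hP]; fun_prop)
  refine ⟨C, hC0, fun s hs b hb i => ?_⟩
  have hb0 := hb.1
  have h1 := kernelMeasure_integral_sub_mul_sub hs hb0 i i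
  simp_rw [← sq, if_true] at h1
  have key := (le_abs_self _).trans (hC (s i) (hs.1 i) b ⟨hb0.le, hb.2⟩)
  have h2 : ∫ x, (x i - s i) ^ 2 ∂(kernelMeasure s b) =
      b * (P (s i, b) / ((1 + (d + 1) * b) * (1 + (d + 2) * b))) := by
    rw [h1, hP]; ring
  rw [h2, mul_comm C]
  gcongr
  rw [div_le_iff₀ (by positivity)]
  refine key.trans (le_mul_of_one_le_right hC0 (one_le_mul_of_one_le_of_one_le ?_ ?_))
  · have : 0 ≤ ((d : ℝ) + 1) * b := by positivity
    linarith
  · have : 0 ≤ ((d : ℝ) + 2) * b := by positivity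
    linarith

theorem abs_kernelMeasure_integral_le {s : Fin d → ℝ} (hs : s ∈ simplex d) {b : ℝ} (hb : 0 < b)
    {h k : (Fin d → ℝ) → ℝ} (hk : ContinuousOn k (simplex d)) (hle : ∀ x ∈ simplex d, |h x| ≤ k x) :
    |∫ x, h x ∂(kernelMeasure s b)| ≤ ∫ x, k x ∂(kernelMeasure s b) := by
  rw [← Real.norm_eq_abs]
  refine norm_integral_le_of_norm_le (integrable_kernelMeasure hs hb hk) ?_
  filter_upwards [ae_kernelMeasure_mem_simplex s b] with x hx using hle x hx

theorem abs_sub_integral_const_le {s : Fin d → ℝ} (hs : s ∈ simplex d) {b : ℝ} (hb : 0 < b)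
    {k T : (Fin d → ℝ) → ℝ} (hf : ContinuousOn f (simplex d)) (hT : Continuous T)
    (hk : Continuous k) (hle : ∀ x ∈ simplex d, |f x - f s - T x| ≤ k x) :
    |∫ x, f x ∂(kernelMeasure s b) - f s - ∫ x, T x ∂(kernelMeasure s b)| ≤
      ∫ x, k x ∂(kernelMeasure s b) := by
  have := isProbabilityMeasure_kernelMeasure hs hb
  have h1 := abs_kernelMeasure_integral_le hs hb hk.continuousOn hle
  have h2 : Integrable (fun x => f x - f s) (kernelMeasure s b) :=
    (integrable_kernelMeasure hs hb hf).sub (integrable_const _)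
  rw [integral_sub h2 (integrable_kernelMeasure_of_continuous hs hb hT),
    integral_sub (integrable_kernelMeasure hs hb hf) (integrable_const _)] at h1
  simpa using h1

/-- In the first-order expansion the linear term averages to the mean displacement and the remainder
to second moments, both O(b) uniformly in s. This is the domination for the integrated squared bias.
-/
theorem exists_abs_bias_le (hf : ContDiffOn ℝ 2 f (simplex d)) :
    ∃ C, 0 ≤ C ∧ ∀ s ∈ simplex d, ∀ b ∈ Set.Ioc (0 : ℝ) 1,
      |∫ x, f x ∂(kernelMeasure s b) - f s| ≤ C * b := by
  obtain ⟨L, hL0, hL⟩ := exists_lipschitz_fderivWithin hf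
  obtain ⟨C, hC0, hC⟩ := exists_kernelMeasure_integral_sub_sq_le d
  choose D hD0 hD using fun i => exists_bound_of_continuousOn (continuousOn_pderiv hf i)
  have hD' : 0 ≤ ∑ i, D i := Finset.sum_nonneg fun i _ => hD0 i
  refine ⟨L * (d * C) + (d + 2) * ∑ i, D i, by positivity, fun s hs b hb => ?_⟩
  have hb0 := hb.1
  have h1 := abs_sub_integral_const_le hs hb0 hf.continuousOn
    (T := fun x => ∑ i, (x i - s i) * pderiv i f s) (k := fun x => L * ∑ i, (x i - s i) ^ 2)
    (by fun_prop) (by fun_prop) fun x hx => by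
      have := abs_sub_taylor_one_le convex_simplex (hasFDerivWithinAt_simplex hf) hL hs hx hL0
      rw [fderivWithin_apply_eq_sum] at this
      exact this.trans (mul_le_mul_of_nonneg_left (norm_sq_le_sum_sq _) hL0)
  have hi : ∀ h : (Fin d → ℝ) → ℝ, Continuous h → Integrable h (kernelMeasure s b) :=
    fun h hh => integrable_kernelMeasure_of_continuous hs hb0 hh
  rw [integral_const_mul, integral_finsetSum _ fun i _ => hi _ (by fun_prop),
    integral_finsetSum _ fun i _ => hi _ (by fun_prop)] at h1
  simp_rw [integral_mul_const] at h1
  have h2 : ∑ i, ∫ x, (x i - s i) ^ 2 ∂(kernelMeasure s b) ≤ d * (C * b) := by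
    refine (Finset.sum_le_sum fun i _ => hC s hs b hb i).trans ?_
    simp
  have h3 : |∑ i, (∫ x, (x i - s i) ∂(kernelMeasure s b)) * pderiv i f s| ≤
      (d + 2) * b * ∑ i, D i := by
    rw [Finset.mul_sum]
    refine (Finset.abs_sum_le_sum_abs _ _).trans (Finset.sum_le_sum fun i _ => ?_)
    rw [abs_mul]
    exact mul_le_mul (abs_kernelMeasure_integral_sub_le hs hb0 i) (hD i s hs) (abs_nonneg _)
      (by positivity)
  have h4 := mul_le_mul_of_nonneg_left h2 hL0
  have h5 := abs_sub_abs_le_abs_sub (∫ x, f x ∂(kernelMeasure s b) - f s)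
    (∑ i, (∫ x, (x i - s i) ∂(kernelMeasure s b)) * pderiv i f s)
  linarith

theorem tendsto_kernelMeasure_integral_sub {s : Fin d → ℝ} (hs : s ∈ simplex d) (i : Fin d) :
    Tendsto (fun b => (∫ x, (x i - s i) ∂(kernelMeasure s b)) / b) (𝓝[>] 0)
      (𝓝 (1 - (d + 1) * s i)) := by
  have h1 : ContinuousAt (fun b : ℝ => (1 - (d + 1) * s i) / (1 + (d + 1) * b)) 0 :=
    ContinuousAt.div (by fun_prop) (by fun_prop) (by simp)
  have h2 := h1.tendsto.mono_left (nhdsWithin_le_nhds (s := Set.Ioi 0))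
  simp only [mul_zero, add_zero, div_one] at h2
  refine h2.congr' ?_
  filter_upwards [self_mem_nhdsWithin] with b hb
  rw [kernelMeasure_integral_sub hs hb, mul_div_cancel_left₀ _ (ne_of_gt hb)]

theorem tendsto_kernelMeasure_integral_sub_mul_sub {s : Fin d → ℝ} (hs : s ∈ simplex d)
    (i j : Fin d) :
    Tendsto (fun b => (∫ x, (x i - s i) * (x j - s j) ∂(kernelMeasure s b)) / b) (𝓝[>] 0)
      (𝓝 (s i * ((if i = j then 1 else 0) - s j))) := by
  have h1 : ContinuousAt (fun b : ℝ => (s i * ((if i = j then 1 else 0) - s j) +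
      b * ((1 + if i = j then 1 else 0) - (d + 2) * (s i + s j) +
      (d + 1) * (d + 2) * (s i * s j))) / ((1 + (d + 1) * b) * (1 + (d + 2) * b))) 0 :=
    ContinuousAt.div (by fun_prop) (by fun_prop) (by simp)
  have h2 := h1.tendsto.mono_left (nhdsWithin_le_nhds (s := Set.Ioi 0))
  simp only [mul_zero, zero_mul, add_zero, div_one, mul_one] at h2
  refine h2.congr' ?_
  filter_upwards [self_mem_nhdsWithin] with b hb
  rw [kernelMeasure_integral_sub_mul_sub hs hb, mul_div_cancel_left₀ _ (ne_of_gt hb)]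

/-- Makes the local Peano estimate global at the price of a quartic term, so that only moments, and
no tail probabilities, are needed. -/
theorem exists_taylor_two_bound (hf : ContDiffOn ℝ 2 f (simplex d)) {s : Fin d → ℝ}
    (hs : s ∈ simplex d) {ε : ℝ} (hε : 0 < ε) :
    ∃ C, 0 ≤ C ∧ ∀ z ∈ simplex d,
      |f z - f s - (∑ i, (z i - s i) * pderiv i f s +
        1 / 2 * ∑ i, ∑ j, (z i - s i) * (z j - s j) * pderiv i (pderiv j f) s)| ≤
      ε * ∑ i, (z i - s i) ^ 2 + C * ∑ i, (z i - s i) ^ 4 := by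
  obtain ⟨L, hL0, hL⟩ := exists_lipschitz_fderivWithin hf
  obtain ⟨δ, hδ, h⟩ := abs_sub_taylor_two_le convex_simplex (hasFDerivWithinAt_simplex hf) hs
    (hasFDerivWithinAt_fderivWithin_simplex hf s hs) hε
  set Q := fderivWithin ℝ (fderivWithin ℝ f (simplex d)) (simplex d) s with hQ
  have hT : ∀ z : Fin d → ℝ, f z - f s - (∑ i, (z i - s i) * pderiv i f s +
        1 / 2 * ∑ i, ∑ j, (z i - s i) * (z j - s j) * pderiv i (pderiv j f) s) =
      f z - f s - fderivWithin ℝ f (simplex d) s (z - s) - 1 / 2 * Q (z - s) (z - s) := by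
    intro z
    rw [hQ, fderivWithin_fderivWithin_apply_eq_sum hf hs, fderivWithin_apply_eq_sum]
    simp only [Pi.sub_apply]
    ring
  refine ⟨(L + ‖Q‖) / δ ^ 2 * d, by positivity, fun z hz => ?_⟩
  rw [hT]
  have hsq : ‖z - s‖ ^ 2 ≤ ∑ i, (z i - s i) ^ 2 := norm_sq_le_sum_sq _
  have hfour : ‖z - s‖ ^ 4 ≤ d * ∑ i, (z i - s i) ^ 4 := norm_pow_four_le_sum_pow_four _
  have hsum4 : 0 ≤ ∑ i, (z i - s i) ^ 4 := Finset.sum_nonneg fun i _ => by positivity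
  -- Within distance δ the Peano estimate applies. Farther away ‖z-s‖² ≤ ‖z-s‖⁴/δ², and the crude
  -- quadratic bounds on the first-order remainder and on the Hessian term are absorbed.
  rcases lt_or_ge ‖z - s‖ δ with hzs | hzs
  · refine (h z hz hzs).trans ?_
    have := mul_le_mul_of_nonneg_left hsq hε.le
    have : 0 ≤ (L + ‖Q‖) / δ ^ 2 * d * ∑ i, (z i - s i) ^ 4 := by positivity
    linarith
  · have h1 := abs_sub_taylor_one_le convex_simplex (hasFDerivWithinAt_simplex hf) hL hs hz hL0
    have h2 : |1 / 2 * Q (z - s) (z - s)| ≤ ‖Q‖ * ‖z - s‖ ^ 2 := by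
      have := Q.le_opNorm₂ (z - s) (z - s)
      rw [Real.norm_eq_abs] at this
      rw [abs_mul, abs_of_pos (by norm_num : (0 : ℝ) < 1 / 2)]
      nlinarith [abs_nonneg (Q (z - s) (z - s))]
    have h3 : (L + ‖Q‖) * ‖z - s‖ ^ 2 ≤ (L + ‖Q‖) / δ ^ 2 * ‖z - s‖ ^ 4 := by
      have : δ ^ 2 ≤ ‖z - s‖ ^ 2 := by gcongr
      have h5 : 1 ≤ ‖z - s‖ ^ 2 / δ ^ 2 := by rwa [one_le_div (by positivity)]
      calc _ ≤ (L + ‖Q‖) * ‖z - s‖ ^ 2 * (‖z - s‖ ^ 2 / δ ^ 2) :=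
            le_mul_of_one_le_right (by positivity) h5
        _ = _ := by ring
    have h4 : (L + ‖Q‖) / δ ^ 2 * ‖z - s‖ ^ 4 ≤
        (L + ‖Q‖) / δ ^ 2 * (d * ∑ i, (z i - s i) ^ 4) := by gcongr
    have h5 : 0 ≤ ε * ∑ i, (z i - s i) ^ 2 :=
      mul_nonneg hε.le ((sq_nonneg _).trans hsq)
    have h6 := abs_sub (f z - f s - fderivWithin ℝ f (simplex d) s (z - s))
      (1 / 2 * Q (z - s) (z - s))
    linarith

theorem tendsto_bias_div (hf : ContDiffOn ℝ 2 f (simplex d)) {s : Fin d → ℝ}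
    (hs : s ∈ simplex d) :
    Tendsto (fun b => (∫ x, f x ∂(kernelMeasure s b) - f s) / b) (𝓝[>] 0)
      (𝓝 (biasCoeff f s)) := by
  obtain ⟨M, hM0, hM⟩ := exists_kernelMeasure_integral_sub_sq_le d
  obtain ⟨K, hK0, hK⟩ := exists_kernelMeasure_integral_sub_pow_four_le d
  have hlim : Tendsto (fun b => ∑ i, (∫ x, (x i - s i) ∂(kernelMeasure s b)) / b * pderiv i f s +
      1 / 2 * ∑ i, ∑ j, (∫ x, (x i - s i) * (x j - s j) ∂(kernelMeasure s b)) / b *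
        pderiv i (pderiv j f) s) (𝓝[>] 0) (𝓝 (biasCoeff f s)) := by
    refine (tendsto_finsetSum _ fun i _ =>
      (tendsto_kernelMeasure_integral_sub hs i).mul_const _).add
      ((tendsto_finsetSum _ fun i _ => tendsto_finsetSum _ fun j _ =>
        (tendsto_kernelMeasure_integral_sub_mul_sub hs i j).mul_const _).const_mul _)
  rw [← tendsto_sub_nhds_zero_iff] at hlim ⊢
  rw [Metric.tendsto_nhds] at hlim ⊢
  intro ε hε
  -- After division by b the remainder is at most ηdM + CdKb. Here η and the bound on b below make
  -- each term at most ε/4; the added 1 keeps the denominators positive.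
  set η := ε / (4 * (d * M + 1)) with hη
  have hη0 : 0 < η := by positivity
  obtain ⟨C, hC0, hC⟩ := exists_taylor_two_bound hf hs hη0
  have hsmall : ∀ᶠ b in 𝓝[>] (0 : ℝ), b < min 1 (ε / (4 * (C * d * K + 1))) :=
    nhdsWithin_le_nhds (eventually_lt_nhds (by positivity))
  filter_upwards [hlim (ε / 2) (by positivity), hsmall, self_mem_nhdsWithin] with b h1 h2 hb0
  have hb0 : 0 < b := hb0
  have hb1 : b ≤ 1 := (h2.trans_le (min_le_left _ _)).le
  have hb2 : b < ε / (4 * (C * d * K + 1)) := h2.trans_le (min_le_right _ _)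
  have hi : ∀ h : (Fin d → ℝ) → ℝ, Continuous h → Integrable h (kernelMeasure s b) :=
    fun h hh => integrable_kernelMeasure_of_continuous hs hb0 hh
  have h3 := abs_sub_integral_const_le hs hb0 hf.continuousOn (by fun_prop) (by fun_prop) hC
  rw [integral_add (hi _ (by fun_prop)) (hi _ (by fun_prop)),
    integral_add (hi _ (by fun_prop)) (hi _ (by fun_prop)),
    integral_const_mul, integral_const_mul, integral_const_mul,
    integral_finsetSum _ fun i _ => hi _ (by fun_prop),
    integral_finsetSum _ fun i _ => hi _ (by fun_prop),
    integral_finsetSum _ fun i _ => hi _ (by fun_prop),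
    integral_finsetSum _ fun i _ => hi _ (by fun_prop)] at h3
  have h6 : ∀ i, ∫ x, ∑ j, (x i - s i) * (x j - s j) * pderiv i (pderiv j f) s
      ∂(kernelMeasure s b) = ∑ j, (∫ x, (x i - s i) * (x j - s j) ∂(kernelMeasure s b)) *
        pderiv i (pderiv j f) s := fun i => by
    rw [integral_finsetSum _ fun j _ => hi _ (by fun_prop)]
    simp_rw [integral_mul_const]
  simp_rw [h6, integral_mul_const] at h3
  have h4 : ∑ i, ∫ x, (x i - s i) ^ 2 ∂(kernelMeasure s b) ≤ d * (M * b) := by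
    refine (Finset.sum_le_sum fun i _ => hM s hs b ⟨hb0, hb1⟩ i).trans ?_
    simp
  have h5 : ∑ i, ∫ x, (x i - s i) ^ 4 ∂(kernelMeasure s b) ≤ d * (K * b ^ 2) := by
    refine (Finset.sum_le_sum fun i _ => hK s hs b ⟨hb0, hb1⟩ i).trans ?_
    simp
  rw [dist_zero_right, Real.norm_eq_abs] at h1 ⊢
  set T := ∑ i, (∫ x, (x i - s i) ∂(kernelMeasure s b)) / b * pderiv i f s +
      1 / 2 * ∑ i, ∑ j, (∫ x, (x i - s i) * (x j - s j) ∂(kernelMeasure s b)) / b *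
        pderiv i (pderiv j f) s with hT
  have h7 : ∑ i, (∫ x, (x i - s i) ∂(kernelMeasure s b)) * pderiv i f s +
      1 / 2 * ∑ i, ∑ j, (∫ x, (x i - s i) * (x j - s j) ∂(kernelMeasure s b)) *
        pderiv i (pderiv j f) s = b * T := by
    simp_rw [hT, div_mul_eq_mul_div, ← Finset.sum_div]
    field_simp
  rw [h7] at h3
  set I := ∫ x, f x ∂(kernelMeasure s b) - f s
  have h8 : |I / b - T| ≤ η * (d * M) + C * d * K * b := by
    have : I / b - T = (I - b * T) / b := by field_simp
    rw [this, abs_div, abs_of_pos hb0, div_le_iff₀ hb0]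
    have := mul_le_mul_of_nonneg_left h4 hη0.le
    have := mul_le_mul_of_nonneg_left h5 hC0
    linarith
  have h9 : η * (d * M) ≤ ε / 4 := by
    rw [hη, div_mul_eq_mul_div, div_le_div_iff₀ (by positivity) (by norm_num)]
    nlinarith
  have h10 : C * d * K * b ≤ ε / 4 := by
    rw [lt_div_iff₀ (by positivity)] at hb2
    nlinarith
  have h11 := abs_add_le (I / b - T) (T - biasCoeff f s)
  rw [show I / b - T + (T - biasCoeff f s) = I / b - biasCoeff f s by ring] at h11
  linarith

end DirichletKernel

/-! ### Gamma ratios and the square of the kernel -/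

namespace DirichletKernel

/-- The ratio `Γ(x + 1/2) / Γ(x + 1)`. -/
noncomputable def gammaRatio (x : ℝ) : ℝ := Real.Gamma (x + 1 / 2) / Real.Gamma (x + 1)

theorem gammaRatio_pos {x : ℝ} (hx : 0 ≤ x) : 0 < gammaRatio x :=
  div_pos (Real.Gamma_pos_of_pos (by linarith)) (Real.Gamma_pos_of_pos (by linarith))

/-- Log-convexity of Γ at the midpoint of x and x+1. Applied at x and at x+1/2 it gives the two
sides of the estimate of `gammaRatio`, in place of Stirling's formula. -/
theorem Gamma_add_half_sq_le {x : ℝ} (hx : 0 < x) :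
    Real.Gamma (x + 1 / 2) ^ 2 ≤ Real.Gamma x * Real.Gamma (x + 1) := by
  have h := Real.Gamma_mul_add_mul_le_rpow_Gamma_mul_rpow_Gamma hx (by linarith : 0 < x + 1)
    (a := 1 / 2) (b := 1 / 2) (by norm_num) (by norm_num) (by norm_num)
  have h1 := Real.Gamma_pos_of_pos hx
  have h2 := Real.Gamma_pos_of_pos (by linarith : 0 < x + 1)
  have h3 := Real.Gamma_pos_of_pos (by linarith : 0 < x + 1 / 2)
  rw [← Real.mul_rpow h1.le h2.le, ← Real.sqrt_eq_rpow,
    show 1 / 2 * x + 1 / 2 * (x + 1) = x + 1 / 2 by ring] at h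
  exact (Real.le_sqrt h3.le (by positivity)).1 h

theorem gammaRatio_le {x : ℝ} (hx : 0 < x) : gammaRatio x ≤ 1 / √x := by
  have h := Gamma_add_half_sq_le hx
  have h1 := Real.Gamma_pos_of_pos hx
  rw [show 1 / √x = √(1 / x) by rw [Real.sqrt_div zero_le_one, Real.sqrt_one], gammaRatio]
  refine Real.le_sqrt_of_sq_le ?_
  rw [Real.Gamma_add_one hx.ne'] at h ⊢
  rw [div_pow, div_le_div_iff₀ (by positivity) hx]
  nlinarith

theorem le_gammaRatio {x : ℝ} (hx : 0 ≤ x) : 1 / √(x + 1 / 2) ≤ gammaRatio x := by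
  have hx2 : 0 < x + 1 / 2 := by linarith
  have h := Gamma_add_half_sq_le hx2
  have h1 := Real.Gamma_pos_of_pos hx2
  have h2 := Real.Gamma_pos_of_pos (by linarith : 0 < x + 1)
  rw [show 1 / √(x + 1 / 2) = √(1 / (x + 1 / 2)) by
    rw [Real.sqrt_div zero_le_one, Real.sqrt_one], gammaRatio]
  refine Real.sqrt_le_iff.2 ⟨by positivity, ?_⟩
  rw [Real.Gamma_add_one hx2.ne', show x + 1 / 2 + 1 / 2 = x + 1 by ring] at h
  rw [div_pow, div_le_div_iff₀ hx2 (by positivity)]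
  nlinarith

/-- The bound holds for every b > 0 and equals the limit as b → 0, so it serves both for domination
and for the squeeze. -/
theorem gammaRatio_div_sqrt_le {a b : ℝ} (ha : 0 < a) (hb : 0 < b) :
    gammaRatio (a / b) / √b ≤ a ^ (-(1 / 2) : ℝ) := by
  have h := gammaRatio_le (div_pos ha hb)
  have hb' := Real.sqrt_pos.2 hb
  have ha' := Real.sqrt_pos.2 ha
  rw [Real.rpow_neg ha.le, ← Real.sqrt_eq_rpow, div_le_iff₀ hb']
  refine h.trans (le_of_eq ?_)
  rw [Real.sqrt_div ha.le]
  field_simp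

theorem tendsto_gammaRatio_div_sqrt {a : ℝ} (ha : 0 < a) :
    Tendsto (fun b => gammaRatio (a / b) / √b) (𝓝[>] 0) (𝓝 (a ^ (-(1 / 2) : ℝ))) := by
  have h1 : ContinuousAt (fun b : ℝ => (a + b / 2) ^ (-(1 / 2) : ℝ)) 0 :=
    ContinuousAt.rpow_const (by fun_prop) (Or.inl (by simpa using ha.ne'))
  have h2 := h1.tendsto.mono_left (nhdsWithin_le_nhds (s := Set.Ioi 0))
  simp only [zero_div, add_zero] at h2
  refine tendsto_of_tendsto_of_tendsto_of_le_of_le' h2 tendsto_const_nhds ?_ ?_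
  · filter_upwards [self_mem_nhdsWithin] with b hb
    have hb : 0 < b := hb
    have h3 := le_gammaRatio (div_pos ha hb).le
    have hb' := Real.sqrt_pos.2 hb
    have h4 : 0 < a + b / 2 := by positivity
    have h4' := Real.sqrt_pos.2 h4
    rw [Real.rpow_neg h4.le, ← Real.sqrt_eq_rpow, le_div_iff₀ hb']
    refine le_trans (le_of_eq ?_) h3
    rw [show a / b + 1 / 2 = (a + b / 2) / b by field_simp, Real.sqrt_div h4.le]
    field_simp
  · filter_upwards [self_mem_nhdsWithin] with b hb using gammaRatio_div_sqrt_le ha hb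

/-- Legendre's duplication formula at x + 1/2. -/
theorem Gamma_two_mul_add_one_div_sq {x : ℝ} (hx : 0 ≤ x) :
    Real.Gamma (2 * x + 1) / Real.Gamma (x + 1) ^ 2 = 4 ^ x * gammaRatio x / √Real.pi := by
  have h := Real.Gamma_mul_Gamma_add_half (x + 1 / 2)
  have h1 := Real.Gamma_pos_of_pos (by linarith : 0 < x + 1)
  rw [show x + 1 / 2 + 1 / 2 = x + 1 by ring, show 2 * (x + 1 / 2) = 2 * x + 1 by ring,
    show 1 - (2 * x + 1) = -(2 * x) by ring, Real.rpow_neg (by norm_num),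
    Real.rpow_mul (by norm_num)] at h
  norm_num at h
  have h4 : (0 : ℝ) < 4 ^ x := by positivity
  have hpi : 0 < √Real.pi := Real.sqrt_pos.2 Real.pi_pos
  rw [gammaRatio]
  field_simp at h ⊢
  linarith

/-- The normalising factor in the square of the Dirichlet kernel, times `b ^ (d + 1/2) * 4 ^ (1/b)`. -/
noncomputable def normFactor (d : ℕ) (b : ℝ) : ℝ :=
  b ^ d * √b * 4 ^ (1 / b) * (Real.Gamma (1 / b + d + 1) ^ 2 / Real.Gamma (2 / b + d + 1))

theorem normFactor_pos (d : ℕ) {b : ℝ} (hb : 0 < b) : 0 < normFactor d b := by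
  have := Real.Gamma_pos_of_pos (by positivity : 0 < 1 / b + d + 1)
  have := Real.Gamma_pos_of_pos (by positivity : 0 < 2 / b + d + 1)
  have := Real.sqrt_pos.2 hb
  unfold normFactor
  positivity

/-- For d = 0 this is duplication at x = 1/b. Raising d by one multiplies the factor by
b(1/b+d+1)²/(2/b+d+1), which tends to 1/2. -/
theorem tendsto_normFactor (d : ℕ) :
    Tendsto (normFactor d) (𝓝[>] 0) (𝓝 (√Real.pi * (1 / 2) ^ d)) := by
  induction d with
  | zero =>
    have h := (tendsto_gammaRatio_div_sqrt one_pos).inv₀ (by simp)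
    have h2 := h.const_mul √Real.pi
    simp only [Real.one_rpow, inv_one, mul_one] at h2
    simp only [pow_zero, mul_one]
    refine h2.congr' ?_
    filter_upwards [self_mem_nhdsWithin] with b hb
    have hb : 0 < b := hb
    have h3 := Gamma_two_mul_add_one_div_sq (x := 1 / b) (by positivity)
    have h4 := gammaRatio_pos (x := 1 / b) (by positivity)
    have h5 := Real.Gamma_pos_of_pos (by positivity : 0 < 1 / b + 1)
    have h6 := Real.Gamma_pos_of_pos (by positivity : 0 < 2 * (1 / b) + 1)
    have hpi : 0 < √Real.pi := Real.sqrt_pos.2 Real.pi_pos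
    have hb' := Real.sqrt_pos.2 hb
    have h7 : Real.Gamma (1 / b + 1) ^ 2 / Real.Gamma (2 * (1 / b) + 1) =
        √Real.pi / (4 ^ (1 / b) * gammaRatio (1 / b)) := by
      rw [← inv_div, h3, inv_div]
    simp only [normFactor, pow_zero, one_mul, Nat.cast_zero, add_zero]
    rw [show 2 / b = 2 * (1 / b) by ring, h7]
    have : (0 : ℝ) < 4 ^ (1 / b) := by positivity
    field_simp
  | succ d ih =>
    have h1 : ContinuousAt (fun b : ℝ => (1 + (d + 1) * b) ^ 2 / (2 + (d + 1) * b)) 0 :=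
      ContinuousAt.div (by fun_prop) (by fun_prop) (by simp)
    have h2 := h1.tendsto.mono_left (nhdsWithin_le_nhds (s := Set.Ioi 0))
    simp only [mul_zero, add_zero, one_pow] at h2
    have h3 := ih.mul h2
    rw [mul_assoc, ← pow_succ] at h3
    refine h3.congr' ?_
    filter_upwards [self_mem_nhdsWithin] with b hb
    have hb : 0 < b := hb
    have h5 := Real.Gamma_pos_of_pos (by positivity : 0 < 1 / b + d + 1)
    have h6 := Real.Gamma_pos_of_pos (by positivity : 0 < 2 / b + d + 1)
    simp only [normFactor, Nat.cast_succ]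
    rw [← add_assoc, ← add_assoc, Real.Gamma_add_one (by positivity : 1 / b + d + 1 ≠ 0),
      Real.Gamma_add_one (by positivity : 2 / b + d + 1 ≠ 0)]
    have : 1 + ((d : ℝ) + 1) * b ≠ 0 := by positivity
    have : 2 + ((d : ℝ) + 1) * b ≠ 0 := by positivity
    have e1 : 1 / b + d + 1 = (1 + (d + 1) * b) / b := by field_simp; ring
    have e2 : 2 / b + d + 1 = (2 + (d + 1) * b) / b := by field_simp; ring
    generalize Real.Gamma (1 / b + d + 1) = g1 at *
    generalize Real.Gamma (2 / b + d + 1) = g2 at *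
    rw [e1, e2]
    field_simp
    ring

variable {d : ℕ}

/-- The factor in the square of the Dirichlet kernel with bandwidth `b`, relative to the Dirichlet
kernel with bandwidth `b / 2`. -/
noncomputable def squareFactor (s : Fin d → ℝ) (b : ℝ) : ℝ :=
  Real.Gamma (1 / b + d + 1) ^ 2 / Real.Gamma (2 / b + d + 1) *
    (Real.Gamma (2 * ((1 - l1 s) / b) + 1) / Real.Gamma ((1 - l1 s) / b + 1) ^ 2 *
      ∏ i, Real.Gamma (2 * (s i / b) + 1) / Real.Gamma (s i / b + 1) ^ 2)

theorem kernel_l1 {s : Fin d → ℝ} (hs : s ∈ simplex d) {b : ℝ} (hb : 0 < b) :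
    l1 (fun i => s i / b + 1) + ((1 - l1 s) / b + 1) = 1 / b + d + 1 := by
  rw [l1_eq_sum fun i => (kernel_alpha_pos hs hb i).le, kernel_sum hs hb]
  field_simp
  ring

/-- Squaring turns the exponents s_i/b into 2s_i/b = s_i/(b/2), so only normalising constants
separate the square from the kernel of bandwidth b/2. -/
theorem dirichletDensity_sq {s x : Fin d → ℝ} (hs : s ∈ simplex d) (hx : x ∈ simplex d) {b : ℝ}
    (hb : 0 < b) :
    dirichletDensity (fun i => s i / b + 1) ((1 - l1 s) / b + 1) x ^ 2 = squareFactor s b *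
      dirichletDensity (fun i => s i / (b / 2) + 1) ((1 - l1 s) / (b / 2) + 1) x := by
  have h2 := kernel_l1 hs (half_pos hb)
  have e (a : ℝ) : a / (b / 2) = 2 * (a / b) := by field_simp
  have hp : ∀ y : ℝ, 0 ≤ y → ∀ a : ℝ, (y ^ (a / b + 1 - 1)) ^ 2 = y ^ (2 * (a / b) + 1 - 1) := by
    intro y hy a
    rw [← Real.rpow_natCast, ← Real.rpow_mul hy]
    congr 1
    push_cast
    ring
  have h3 : 0 ≤ 1 - l1 x := by linarith [l1_le_one hx]
  simp only [dirichletDensity]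
  rw [h2, kernel_l1 hs hb, squareFactor]
  simp only [e]
  rw [mul_pow, mul_pow, div_pow, hp _ h3, ← Finset.prod_pow,
    Finset.prod_congr rfl fun i _ => hp _ (simplex_nonneg hx i) (s i), Finset.prod_div_distrib,
    mul_pow, Finset.prod_pow]
  have g0 : Real.Gamma (2 * (1 / b) + d + 1) ≠ 0 :=
    (Real.Gamma_pos_of_pos (by positivity)).ne'
  have g1 : Real.Gamma (2 * ((1 - l1 s) / b) + 1) ≠ 0 := by
    have := kernel_beta_pos hs (half_pos hb)
    rw [e] at this
    exact (Real.Gamma_pos_of_pos this).ne'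
  have g2 : ∏ i, Real.Gamma (2 * (s i / b) + 1) ≠ 0 := by
    refine Finset.prod_ne_zero_iff.2 fun i _ => ?_
    have := kernel_alpha_pos hs (half_pos hb) i
    rw [e] at this
    exact (Real.Gamma_pos_of_pos this).ne'
  have g3 : Real.Gamma ((1 - l1 s) / b + 1) ≠ 0 :=
    (Real.Gamma_pos_of_pos (kernel_beta_pos hs hb)).ne'
  have g4 : ∏ i, Real.Gamma (s i / b + 1) ≠ 0 :=
    Finset.prod_ne_zero_iff.2 fun i _ => (Real.Gamma_pos_of_pos (kernel_alpha_pos hs hb i)).ne'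
  rw [show (2 : ℝ) / b = 2 * (1 / b) by ring]
  generalize Real.Gamma (2 * (1 / b) + d + 1) = u0 at *
  generalize Real.Gamma (2 * ((1 - l1 s) / b) + 1) = u1 at *
  generalize ∏ i, Real.Gamma (2 * (s i / b) + 1) = u2 at *
  generalize Real.Gamma ((1 - l1 s) / b + 1) = u3 at *
  generalize ∏ i, Real.Gamma (s i / b + 1) = u4 at *
  generalize (1 - l1 x) ^ (2 * ((1 - l1 s) / b) + 1 - 1) = v1
  generalize ∏ i, x i ^ (2 * (s i / b) + 1 - 1) = v2
  field_simp

theorem sqrt_pow_mul_squareFactor {s : Fin d → ℝ} (hs : s ∈ simplex d) {b : ℝ} (hb : 0 < b) :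
    √b ^ d * squareFactor s b = normFactor d b / √Real.pi ^ (d + 1) *
      (gammaRatio ((1 - l1 s) / b) / √b * ∏ i, gammaRatio (s i / b) / √b) := by
  have h0 : 0 ≤ 1 - l1 s := by linarith [l1_le_one hs]
  have h1 : ∏ i, Real.Gamma (2 * (s i / b) + 1) / Real.Gamma (s i / b + 1) ^ 2 =
      4 ^ (∑ i, s i / b) * (∏ i, gammaRatio (s i / b)) / √Real.pi ^ d := by
    rw [Finset.prod_congr rfl fun i _ => Gamma_two_mul_add_one_div_sq
      (div_nonneg (simplex_nonneg hs i) hb.le), Finset.prod_div_distrib, Finset.prod_mul_distrib,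
      Real.rpow_sum_of_pos (by norm_num)]
    simp
  -- The powers of 4 from the duplications cancel that in `normFactor`, since the exponents s_i/b
  -- and (1-‖s‖₁)/b add up to 1/b.
  have h2 : (4 : ℝ) ^ (1 / b) = 4 ^ ((1 - l1 s) / b) * 4 ^ (∑ i, s i / b) := by
    rw [← Real.rpow_add (by norm_num), ← Finset.sum_div, l1_simplex hs]
    congr 1
    ring
  have h3 : √b ^ d * √b ^ d = b ^ d := by
    rw [← mul_pow, Real.mul_self_sqrt hb.le]
  have hpi : 0 < √Real.pi := Real.sqrt_pos.2 Real.pi_pos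
  have hb' := Real.sqrt_pos.2 hb
  rw [squareFactor, h1, Gamma_two_mul_add_one_div_sq (div_nonneg h0 hb.le), normFactor, h2,
    Finset.prod_div_distrib, ← h3]
  simp only [Finset.prod_const, Finset.card_univ, Fintype.card_fin]
  field_simp
  ring

end DirichletKernel

/-! ### Integrability of ψ, and the two limits under the integral sign -/

namespace DirichletKernel

variable {d : ℕ} {f : (Fin d → ℝ) → ℝ}

theorem volume_sum_eq_one (d : ℕ) : volume {s : Fin d → ℝ | ∑ i, s i = 1} = 0 := by
  let H : AffineSubspace ℝ (Fin d → ℝ) :=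
    { carrier := {s | ∑ i, s i = 1}
      smul_vsub_vadd_mem' := by
        intro c p₁ p₂ p₃ h₁ h₂ h₃
        simp only [Set.mem_ofPred_eq] at h₁ h₂ h₃
        simp [Finset.sum_add_distrib, ← Finset.mul_sum, h₁, h₂, h₃] }
  refine Measure.addHaar_affineSubspace volume H fun h => ?_
  have h0 : (0 : Fin d → ℝ) ∈ H := h ▸ AffineSubspace.mem_top ℝ _ _
  have h1 : ∑ i, (0 : Fin d → ℝ) i = 1 := h0
  simp at h1

/-- The faces lie in hyperplanes. Away from them every argument of `gammaRatio` is positive and ψ is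
an effective bound. -/
theorem ae_simplex_pos : ∀ᵐ s ∂(volume.restrict (simplex d)),
    s ∈ simplex d ∧ (∀ i, 0 < s i) ∧ 0 < 1 - l1 s := by
  have h1 : ∀ᵐ s : Fin d → ℝ, ∑ i, s i ≠ 1 := by
    rw [ae_iff]; simpa using volume_sum_eq_one d
  have h2 : ∀ᵐ s : Fin d → ℝ, ∀ i, s i ≠ 0 := by
    rw [ae_all_iff]
    intro i
    rw [ae_iff]
    simpa [volume_pi] using Measure.pi_hyperplane (fun _ : Fin d => (volume : Measure ℝ)) i 0
  filter_upwards [ae_restrict_of_ae h1, ae_restrict_of_ae h2, ae_restrict_mem measurableSet_simplex]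
    with s h1 h2 hs
  refine ⟨hs, fun i => lt_of_le_of_ne (simplex_nonneg hs i) (h2 i).symm, ?_⟩
  have h3 := l1_le_one hs
  rw [l1_simplex hs] at h3 ⊢
  exact sub_pos.2 (lt_of_le_of_ne h3 h1)

theorem psi_eq {s : Fin d → ℝ} (hs : s ∈ simplex d) :
    psi s = ((4 * Real.pi) ^ d) ^ (-(1 / 2) : ℝ) *
      ((1 - l1 s) ^ (-(1 / 2) : ℝ) * ∏ i, s i ^ (-(1 / 2) : ℝ)) := by
  have h0 : 0 ≤ 1 - l1 s := by linarith [l1_le_one hs]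
  have h1 : 0 ≤ ∏ i, s i := Finset.prod_nonneg fun i _ => simplex_nonneg hs i
  have hpi := Real.pi_pos
  rw [psi, Real.mul_rpow (by positivity) h1, Real.mul_rpow (by positivity) h0, mul_assoc,
    Real.finsetProd_rpow _ _ fun i _ => simplex_nonneg hs i]

theorem psi_nonneg {s : Fin d → ℝ} (hs : s ∈ simplex d) : 0 ≤ psi s := by
  have h0 : 0 ≤ 1 - l1 s := by linarith [l1_le_one hs]
  have h1 : 0 ≤ ∏ i, s i := Finset.prod_nonneg fun i _ => simplex_nonneg hs i
  have hpi := Real.pi_pos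
  unfold psi
  positivity

theorem psi_pos {s : Fin d → ℝ} (hs : ∀ i, 0 < s i) (hs' : 0 < 1 - l1 s) : 0 < psi s := by
  have h1 : 0 < ∏ i, s i := Finset.prod_pos fun i _ => hs i
  have hpi := Real.pi_pos
  unfold psi
  positivity

theorem measurable_psi : Measurable (psi : (Fin d → ℝ) → ℝ) := by
  have := measurable_l1 (d := d)
  unfold psi
  fun_prop

/-- Up to a constant, ψ is the unnormalised Dirichlet density with all parameters 1/2. -/
theorem integrableOn_psi : IntegrableOn psi (simplex d) := by
  refine ⟨measurable_psi.aestronglyMeasurable, ?_⟩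
  rw [hasFiniteIntegral_iff_ofReal
    ((ae_restrict_mem measurableSet_simplex).mono fun s hs => psi_nonneg hs)]
  have h : ∀ s ∈ simplex d, ENNReal.ofReal (psi s) =
      ENNReal.ofReal (((4 * Real.pi) ^ d) ^ (-(1 / 2) : ℝ)) * ENNReal.ofReal
        ((∏ i, s i ^ ((1 / 2 : ℝ) - 1)) * (1 - ∑ i, s i) ^ ((1 / 2 : ℝ) - 1)) := by
    intro s hs
    have hpi := Real.pi_pos
    rw [psi_eq hs, ENNReal.ofReal_mul (by positivity), l1_simplex hs, mul_comm (∏ i, _)]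
    norm_num
  rw [setLIntegral_congr_fun measurableSet_simplex h,
    lintegral_const_mul' _ _ ENNReal.ofReal_ne_top, simplex_eq_scaledSimplex,
    lintegral_scaledSimplex (fun _ => 1 / 2) (by norm_num) (by norm_num) one_pos]
  exact ENNReal.mul_lt_top ENNReal.ofReal_lt_top ENNReal.ofReal_lt_top

theorem integrableOn_psi_mul (hf : ContinuousOn f (simplex d)) :
    IntegrableOn (fun s => psi s * f s) (simplex d) := by
  obtain ⟨C, -, hC⟩ := exists_bound_of_continuousOn hf
  refine Integrable.mul_bdd (c := C) integrableOn_psi (hf.aestronglyMeasurable measurableSet_simplex) ?_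
  filter_upwards [ae_restrict_mem measurableSet_simplex] with s hs using hC s hs

/-- The truncation avoids the poles of Γ, and on the simplex the kernel's parameters are already at
least 1. This gives joint measurability in base point and observation. -/
theorem continuous_Gamma_max : Continuous fun x : ℝ => Real.Gamma (max x 1) := by
  rw [continuous_iff_continuousAt]
  intro x
  refine ContinuousAt.comp (g := Real.Gamma) (f := fun x : ℝ => max x 1) ?_ (by fun_prop)
  refine (Real.differentiableAt_Gamma fun m h => ?_).continuousAt
  have h1 : (1 : ℝ) ≤ max x 1 := le_max_right _ _
  have h2 : (0 : ℝ) ≤ m := Nat.cast_nonneg m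
  linarith

/-- A jointly measurable version of the Dirichlet kernel. -/
noncomputable def kernelExt (b : ℝ) (p : (Fin d → ℝ) × (Fin d → ℝ)) : ℝ :=
  Real.Gamma (1 / b + d + 1) / (Real.Gamma (max ((1 - l1 p.1) / b + 1) 1) *
    ∏ i, Real.Gamma (max (p.1 i / b + 1) 1)) *
    ((1 - l1 p.2) ^ ((1 - l1 p.1) / b + 1 - 1) * ∏ i, p.2 i ^ (p.1 i / b + 1 - 1))

theorem measurable_kernelExt (b : ℝ) : Measurable (kernelExt (d := d) b) := by
  have h1 : Measurable (fun p : (Fin d → ℝ) × (Fin d → ℝ) => l1 p.1) :=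
    measurable_l1.comp measurable_fst
  have h2 : Measurable (fun p : (Fin d → ℝ) × (Fin d → ℝ) => l1 p.2) :=
    measurable_l1.comp measurable_snd
  have h3 : Measurable (fun p : (Fin d → ℝ) × (Fin d → ℝ) =>
      Real.Gamma (max ((1 - l1 p.1) / b + 1) 1)) :=
    continuous_Gamma_max.measurable.comp (by fun_prop)
  have h4 : ∀ i, Measurable (fun p : (Fin d → ℝ) × (Fin d → ℝ) =>
      Real.Gamma (max (p.1 i / b + 1) 1)) := fun i =>
    continuous_Gamma_max.measurable.comp (by fun_prop)
  unfold kernelExt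
  fun_prop

theorem dirichletDensity_eq_kernelExt {s : Fin d → ℝ} (hs : s ∈ simplex d) {b : ℝ} (hb : 0 < b)
    (x : Fin d → ℝ) :
    dirichletDensity (fun i => s i / b + 1) ((1 - l1 s) / b + 1) x = kernelExt b (s, x) := by
  have h0 : 0 ≤ 1 - l1 s := by linarith [l1_le_one hs]
  have h1 : ∀ a : ℝ, 0 ≤ a → max (a / b + 1) 1 = a / b + 1 := fun a ha =>
    max_eq_left (by have : 0 ≤ a / b := by positivity
                    linarith)
  simp only [dirichletDensity, kernelExt]
  rw [kernel_l1 hs hb, h1 _ h0, Finset.prod_congr rfl fun i _ =>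
    congrArg Real.Gamma (h1 _ (simplex_nonneg hs i))]

/-- Used with k = 1 for the mean and k = 2 for the second moment. As f is controlled only on the
simplex, a strongly measurable version of it enters the parametric integral. -/
theorem aestronglyMeasurable_integral_kernel_pow (hf : ContinuousOn f (simplex d)) {b : ℝ}
    (hb : 0 < b) (k : ℕ) :
    AEStronglyMeasurable (fun s => ∫ x in simplex d,
      dirichletDensity (fun i => s i / b + 1) ((1 - l1 s) / b + 1) x ^ k * f x)
      (volume.restrict (simplex d)) := by
  have hfm := hf.aestronglyMeasurable (μ := volume) measurableSet_simplex
  refine ⟨fun s => ∫ x in simplex d, kernelExt b (s, x) ^ k * hfm.mk f x, ?_, ?_⟩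
  · refine StronglyMeasurable.integral_prod_right (f := fun s x =>
      kernelExt b (s, x) ^ k * hfm.mk f x) ?_
    exact (((measurable_kernelExt b).pow_const k).mul
      (hfm.stronglyMeasurable_mk.measurable.comp measurable_snd)).stronglyMeasurable
  · filter_upwards [ae_restrict_mem measurableSet_simplex] with s hs
    refine integral_congr_ae ?_
    filter_upwards [hfm.ae_eq_mk] with x hx
    rw [dirichletDensity_eq_kernelExt hs hb, hx]

/-- The second moment of the Dirichlet kernel at `s` under the density `f`. -/
noncomputable def secondMoment (f : (Fin d → ℝ) → ℝ) (b : ℝ) (s : Fin d → ℝ) : ℝ :=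
  ∫ x in simplex d, dirichletDensity (fun i => s i / b + 1) ((1 - l1 s) / b + 1) x ^ 2 * f x

theorem secondMoment_eq {s : Fin d → ℝ} (hs : s ∈ simplex d) {b : ℝ} (hb : 0 < b) :
    secondMoment f b s = squareFactor s b * ∫ x, f x ∂(kernelMeasure s (b / 2)) := by
  rw [kernelMeasure, integral_dirichletMeasure (kernel_alpha_pos hs (half_pos hb))
    (kernel_beta_pos hs (half_pos hb)), ← integral_const_mul, secondMoment]
  refine setIntegral_congr_fun measurableSet_simplex fun x hx => ?_
  rw [dirichletDensity_sq hs hx hb, mul_assoc]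

/-- The constant `√b ^ d * squareFactor s b` is compared with `psi s` up to this factor. -/
noncomputable def psiFactor (d : ℕ) (b : ℝ) : ℝ :=
  normFactor d b / √Real.pi ^ (d + 1) / ((4 * Real.pi) ^ d) ^ (-(1 / 2) : ℝ)

theorem psiFactor_nonneg (d : ℕ) {b : ℝ} (hb : 0 < b) : 0 ≤ psiFactor d b := by
  have := normFactor_pos d hb
  have := Real.pi_pos
  unfold psiFactor
  positivity

theorem tendsto_psiFactor (d : ℕ) : Tendsto (psiFactor d) (𝓝[>] 0) (𝓝 1) := by
  have h := ((tendsto_normFactor d).div_const (√Real.pi ^ (d + 1))).div_const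
    (((4 * Real.pi) ^ d) ^ (-(1 / 2) : ℝ))
  have hpi := Real.pi_pos
  have hpi' : 0 < √Real.pi := Real.sqrt_pos.2 Real.pi_pos
  have h1 : ((4 * Real.pi) ^ d) ^ (-(1 / 2) : ℝ) = ((2 * √Real.pi) ^ d)⁻¹ := by
    rw [Real.rpow_neg (by positivity), ← Real.sqrt_eq_rpow,
      show (4 * Real.pi) ^ d = ((2 * √Real.pi) ^ d) ^ 2 by
        rw [← pow_mul, mul_comm d 2, pow_mul, mul_pow 2 √Real.pi 2, Real.sq_sqrt hpi.le]
        norm_num,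
      Real.sqrt_sq (by positivity)]
  -- The constants of the duplications match the factor (4π)^d in ψ exactly.
  have h2 : √Real.pi * (1 / 2) ^ d / √Real.pi ^ (d + 1) / ((4 * Real.pi) ^ d) ^ (-(1 / 2) : ℝ)
      = 1 := by
    rw [h1, mul_pow, pow_succ, one_div, inv_pow]
    field_simp
  rwa [h2] at h

theorem sqrt_pow_mul_squareFactor_eq {s : Fin d → ℝ} (hs : s ∈ simplex d) {b : ℝ} (hb : 0 < b) :
    √b ^ d * squareFactor s b = psiFactor d b * (((4 * Real.pi) ^ d) ^ (-(1 / 2) : ℝ) *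
      (gammaRatio ((1 - l1 s) / b) / √b * ∏ i, gammaRatio (s i / b) / √b)) := by
  have hpi := Real.pi_pos
  have : ((4 * Real.pi) ^ d) ^ (-(1 / 2) : ℝ) ≠ 0 := by positivity
  rw [sqrt_pow_mul_squareFactor hs hb, psiFactor]
  field_simp

theorem squareFactor_nonneg {s : Fin d → ℝ} (hs : s ∈ simplex d) {b : ℝ} (hb : 0 < b) :
    0 ≤ √b ^ d * squareFactor s b := by
  have h0 : 0 ≤ 1 - l1 s := by linarith [l1_le_one hs]
  rw [sqrt_pow_mul_squareFactor hs hb]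
  have h1 := (gammaRatio_pos (div_nonneg h0 hb.le)).le
  have h2 : 0 ≤ ∏ i, gammaRatio (s i / b) / √b := Finset.prod_nonneg fun i _ =>
    div_nonneg (gammaRatio_pos (div_nonneg (simplex_nonneg hs i) hb.le)).le (Real.sqrt_nonneg b)
  have := normFactor_pos d hb
  positivity

theorem sqrt_pow_mul_squareFactor_le {s : Fin d → ℝ} (hs : s ∈ simplex d) (hs0 : ∀ i, 0 < s i)
    (hs1 : 0 < 1 - l1 s) {b : ℝ} (hb : 0 < b) :
    √b ^ d * squareFactor s b ≤ psiFactor d b * psi s := by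
  have hpi := Real.pi_pos
  have := psiFactor_nonneg d hb
  have h1 : ∀ i, 0 ≤ gammaRatio (s i / b) / √b := fun i =>
    div_nonneg (gammaRatio_pos (div_nonneg (simplex_nonneg hs i) hb.le)).le (Real.sqrt_nonneg b)
  rw [sqrt_pow_mul_squareFactor_eq hs hb, psi_eq hs]
  gcongr
  · exact Finset.prod_nonneg fun i _ => h1 i
  · exact gammaRatio_div_sqrt_le hs1 hb
  · exact fun i _ => h1 i
  · exact gammaRatio_div_sqrt_le (hs0 _) hb

theorem tendsto_sqrt_pow_mul_squareFactor {s : Fin d → ℝ} (hs : s ∈ simplex d)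
    (hs0 : ∀ i, 0 < s i) (hs1 : 0 < 1 - l1 s) :
    Tendsto (fun b => √b ^ d * squareFactor s b) (𝓝[>] 0) (𝓝 (psi s)) := by
  have h := (tendsto_psiFactor d).mul (((tendsto_gammaRatio_div_sqrt hs1).mul
    (tendsto_finsetProd Finset.univ fun i _ => tendsto_gammaRatio_div_sqrt (hs0 i))).const_mul
    (((4 * Real.pi) ^ d) ^ (-(1 / 2) : ℝ)))
  rw [one_mul, ← psi_eq hs] at h
  refine h.congr' ?_
  filter_upwards [self_mem_nhdsWithin] with b hb
  rw [sqrt_pow_mul_squareFactor_eq hs hb]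

theorem abs_integral_kernelMeasure_le {s : Fin d → ℝ} (hs : s ∈ simplex d) {b : ℝ} (hb : 0 < b)
    {C : ℝ} (hC : ∀ x ∈ simplex d, |f x| ≤ C) : |∫ x, f x ∂(kernelMeasure s b)| ≤ C := by
  have := isProbabilityMeasure_kernelMeasure hs hb
  simpa using abs_kernelMeasure_integral_le hs hb (k := fun _ => C) continuousOn_const hC

theorem abs_sqrt_pow_mul_secondMoment_le {C : ℝ} (hC : ∀ x ∈ simplex d, |f x| ≤ C)
    {s : Fin d → ℝ} (hs : s ∈ simplex d) (hs0 : ∀ i, 0 < s i) (hs1 : 0 < 1 - l1 s) {b : ℝ}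
    (hb : 0 < b) : |√b ^ d * secondMoment f b s| ≤ psiFactor d b * psi s * C := by
  rw [secondMoment_eq hs hb, ← mul_assoc, abs_mul, abs_of_nonneg (squareFactor_nonneg hs hb)]
  exact mul_le_mul (sqrt_pow_mul_squareFactor_le hs hs0 hs1 hb)
    (abs_integral_kernelMeasure_le hs (half_pos hb) hC) (abs_nonneg _)
    (mul_nonneg (psiFactor_nonneg d hb) (psi_nonneg hs))

theorem integrableOn_secondMoment (hf : ContinuousOn f (simplex d)) {b : ℝ} (hb : 0 < b) :
    IntegrableOn (secondMoment f b) (simplex d) := by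
  obtain ⟨C, -, hC⟩ := exists_bound_of_continuousOn hf
  have hb' : 0 < √b ^ d := pow_pos (Real.sqrt_pos.2 hb) d
  have h : IntegrableOn (fun s => √b ^ d * secondMoment f b s) (simplex d) := by
    refine ((integrableOn_psi.const_mul (psiFactor d b)).mul_const C).mono'
      ((aestronglyMeasurable_integral_kernel_pow hf hb 2).const_mul _) ?_
    filter_upwards [ae_simplex_pos] with s hs
    exact abs_sqrt_pow_mul_secondMoment_le hC hs.1 hs.2.1 hs.2.2 hb
  have h2 := h.const_mul (√b ^ d)⁻¹
  refine h2.congr (ae_of_all _ fun s => ?_)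
  simp only
  rw [inv_mul_cancel_left₀ hb'.ne']

theorem tendsto_integral_kernelMeasure (hf : ContDiffOn ℝ 2 f (simplex d)) {s : Fin d → ℝ}
    (hs : s ∈ simplex d) :
    Tendsto (fun b => ∫ x, f x ∂(kernelMeasure s b)) (𝓝[>] 0) (𝓝 (f s)) := by
  obtain ⟨C, -, hC⟩ := exists_abs_bias_le hf
  rw [← tendsto_sub_nhds_zero_iff]
  have h0 : Tendsto (fun b : ℝ => C * b) (𝓝[>] 0) (𝓝 0) := by
    have : Tendsto (fun b : ℝ => C * b) (𝓝 0) (𝓝 (C * 0)) := tendsto_id.const_mul C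
    rw [mul_zero] at this
    exact this.mono_left nhdsWithin_le_nhds
  refine squeeze_zero_norm' ?_ h0
  filter_upwards [Ioc_mem_nhdsGT one_pos] with b hb using hC s hs b hb

theorem tendsto_half_nhdsGT : Tendsto (fun b : ℝ => b / 2) (𝓝[>] 0) (𝓝[>] 0) := by
  refine tendsto_nhdsWithin_iff.2 ⟨?_, ?_⟩
  · have : Tendsto (fun b : ℝ => b / 2) (𝓝 0) (𝓝 (0 / 2)) := tendsto_id.div_const 2
    rw [zero_div] at this
    exact this.mono_left nhdsWithin_le_nhds
  · filter_upwards [self_mem_nhdsWithin] with b hb using half_pos (Set.mem_Ioi.1 hb)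

/-- The normalised constant tends to ψ(s) and the average of f at bandwidth b/2 tends to f(s). -/
theorem tendsto_integral_secondMoment (hf : ContDiffOn ℝ 2 f (simplex d)) :
    Tendsto (fun b => √b ^ d * ∫ s in simplex d, secondMoment f b s) (𝓝[>] 0)
      (𝓝 (∫ s in simplex d, psi s * f s)) := by
  obtain ⟨C, hC0, hC⟩ := exists_bound_of_continuousOn hf.continuousOn
  simp_rw [← integral_const_mul]
  -- The 2 bounds `psiFactor d b` for small b, as that factor tends to 1.
  refine tendsto_integral_filter_of_dominated_convergence (fun s => 2 * psi s * C) ?_ ?_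
    ((integrableOn_psi.const_mul 2).mul_const C) ?_
  · filter_upwards [self_mem_nhdsWithin] with b hb
    exact (aestronglyMeasurable_integral_kernel_pow hf.continuousOn hb 2).const_mul _
  · filter_upwards [self_mem_nhdsWithin,
      (tendsto_psiFactor d).eventually (eventually_le_nhds one_lt_two)] with b hb h2
    filter_upwards [ae_simplex_pos] with s hs
    refine (abs_sqrt_pow_mul_secondMoment_le hC hs.1 hs.2.1 hs.2.2 hb).trans ?_
    have := psi_nonneg hs.1
    gcongr
  · filter_upwards [ae_simplex_pos] with s hs
    refine ((tendsto_sqrt_pow_mul_squareFactor hs.1 hs.2.1 hs.2.2).mul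
      ((tendsto_integral_kernelMeasure hf hs.1).comp tendsto_half_nhdsGT)).congr' ?_
    filter_upwards [self_mem_nhdsWithin] with b hb
    rw [secondMoment_eq hs.1 hb, mul_assoc]
    rfl

theorem aestronglyMeasurable_integral_kernelMeasure (hf : ContinuousOn f (simplex d)) {b : ℝ}
    (hb : 0 < b) :
    AEStronglyMeasurable (fun s => ∫ x, f x ∂(kernelMeasure s b)) (volume.restrict (simplex d)) := by
  refine (aestronglyMeasurable_integral_kernel_pow hf hb 1).congr ?_
  filter_upwards [ae_restrict_mem measurableSet_simplex] with s hs
  rw [kernelMeasure, integral_dirichletMeasure (kernel_alpha_pos hs hb) (kernel_beta_pos hs hb)]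
  simp_rw [pow_one]

theorem integrableOn_simplex_of_bound {h : (Fin d → ℝ) → ℝ}
    (hm : AEStronglyMeasurable h (volume.restrict (simplex d))) (C : ℝ)
    (hC : ∀ x ∈ simplex d, |h x| ≤ C) : IntegrableOn h (simplex d) :=
  IntegrableOn.of_bound volume_simplex_lt_top hm C
    ((ae_restrict_mem measurableSet_simplex).mono hC)

theorem integrableOn_sq_integral_kernelMeasure (hf : ContinuousOn f (simplex d)) {b : ℝ}
    (hb : 0 < b) : IntegrableOn (fun s => (∫ x, f x ∂(kernelMeasure s b)) ^ 2) (simplex d) := by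
  obtain ⟨C, hC0, hC⟩ := exists_bound_of_continuousOn hf
  refine integrableOn_simplex_of_bound ((aestronglyMeasurable_integral_kernelMeasure hf hb).pow 2)
    (C ^ 2) fun s hs => ?_
  rw [abs_pow]
  gcongr
  exact abs_integral_kernelMeasure_le hs hb hC

theorem integrableOn_sq_bias (hf : ContinuousOn f (simplex d)) {b : ℝ}
    (hb : 0 < b) : IntegrableOn (fun s => (∫ x, f x ∂(kernelMeasure s b) - f s) ^ 2)
      (simplex d) := by
  obtain ⟨C, hC0, hC⟩ := exists_bound_of_continuousOn hf
  refine integrableOn_simplex_of_bound (((aestronglyMeasurable_integral_kernelMeasure hf hb).sub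
    (hf.aestronglyMeasurable measurableSet_simplex)).pow 2) ((C + C) ^ 2) fun s hs => ?_
  rw [abs_pow]
  gcongr
  exact (abs_sub _ _).trans (add_le_add (abs_integral_kernelMeasure_le hs hb hC) (hC s hs))

theorem integrableOn_sq_biasCoeff (hf : ContDiffOn ℝ 2 f (simplex d)) :
    IntegrableOn (fun s => biasCoeff f s ^ 2) (simplex d) :=
  ((continuousOn_biasCoeff hf).pow 2).integrableOn_compact isCompact_simplex

theorem tendsto_integral_sq_bias (hf : ContDiffOn ℝ 2 f (simplex d)) :
    Tendsto (fun b => (∫ s in simplex d, (∫ x, f x ∂(kernelMeasure s b) - f s) ^ 2) / b ^ 2)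
      (𝓝[>] 0) (𝓝 (∫ s in simplex d, biasCoeff f s ^ 2)) := by
  obtain ⟨C, hC0, hC⟩ := exists_abs_bias_le hf
  simp_rw [← integral_div, ← div_pow]
  refine tendsto_integral_filter_of_dominated_convergence (fun s => C ^ 2) ?_ ?_
    (integrableOn_const volume_simplex_lt_top.ne) ?_
  · filter_upwards [self_mem_nhdsWithin] with b hb
    simp_rw [div_eq_mul_inv]
    exact ((((aestronglyMeasurable_integral_kernelMeasure hf.continuousOn hb).sub
      (hf.continuousOn.aestronglyMeasurable measurableSet_simplex)).mul_const b⁻¹).pow 2)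
  · filter_upwards [Ioc_mem_nhdsGT one_pos] with b hb
    filter_upwards [ae_restrict_mem measurableSet_simplex] with s hs
    rw [norm_pow, Real.norm_eq_abs, abs_div, abs_of_pos hb.1]
    have := hb.1
    gcongr
    rw [div_le_iff₀ hb.1]
    exact hC s hs b hb
  · filter_upwards [ae_restrict_mem measurableSet_simplex] with s hs
    exact (tendsto_bias_div hf hs).pow 2

end DirichletKernel

/-! ### From the observations to the error decomposition -/

namespace DirichletKernel

variable {d : ℕ} {f : (Fin d → ℝ) → ℝ}

/-- With parameters at least 1 all powers are at most 1. Hence for fixed s and b the kernel is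
bounded and square integrable under any law on the simplex. -/
theorem dirichletDensity_le {α : Fin d → ℝ} {β : ℝ} (hα : ∀ i, 1 ≤ α i) (hβ : 1 ≤ β)
    {x : Fin d → ℝ} (hx : x ∈ simplex d) :
    dirichletDensity α β x ≤ Real.Gamma (l1 α + β) / (Real.Gamma β * ∏ i, Real.Gamma (α i)) := by
  have hα' : ∀ i, 0 < α i := fun i => one_pos.trans_le (hα i)
  have h0 : 0 ≤ 1 - l1 x := by linarith [l1_le_one hx]
  have h0' : 0 ≤ l1 x := Finset.sum_nonneg fun i _ => abs_nonneg _
  have h1 : 0 < l1 α + β := by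
    have : 0 ≤ l1 α := Finset.sum_nonneg fun i _ => abs_nonneg _
    linarith
  have h2 := (Real.Gamma_pos_of_pos h1).le
  have h3 := (Real.Gamma_pos_of_pos (by linarith : 0 < β)).le
  have h4 : 0 ≤ ∏ i, Real.Gamma (α i) :=
    Finset.prod_nonneg fun i _ => (Real.Gamma_pos_of_pos (hα' i)).le
  refine mul_le_of_le_one_right (by positivity) (mul_le_one₀ ?_ ?_ ?_)
  · exact Real.rpow_le_one h0 (by linarith) (by linarith)
  · exact Finset.prod_nonneg fun i _ => Real.rpow_nonneg (simplex_nonneg hx i) _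
  · exact Finset.prod_le_one (fun i _ => Real.rpow_nonneg (simplex_nonneg hx i) _) fun i _ =>
      Real.rpow_le_one (simplex_nonneg hx i) (simplex_le_one hx i) (by linarith [hα i])

section Law

variable {Ω : Type*} [MeasurableSpace Ω] {P : Measure Ω}
  {X : ℕ → Ω → Fin d → ℝ}

theorem integral_density_eq_one [IsProbabilityMeasure P]
    (hf_nonneg : ∀ s ∈ simplex d, 0 ≤ f s)
    (hf : ContinuousOn f (simplex d)) (hX_meas : Measurable (X 0))
    (hX_law : P.map (X 0) =
      (volume.restrict (simplex d)).withDensity fun x => ENNReal.ofReal (f x)) :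
    ∫ s in simplex d, f s = 1 := by
  have := Measure.isProbabilityMeasure_map (μ := P) hX_meas.aemeasurable
  rw [hX_law] at this
  have h1 := this.measure_univ
  rw [withDensity_apply _ MeasurableSet.univ, Measure.restrict_univ] at h1
  rw [integral_eq_lintegral_of_nonneg_ae
    ((ae_restrict_mem measurableSet_simplex).mono hf_nonneg)
    (hf.aestronglyMeasurable measurableSet_simplex), h1, ENNReal.toReal_one]

theorem integral_comp_of_law (hf_nonneg : ∀ s ∈ simplex d, 0 ≤ f s)
    (hf : ContinuousOn f (simplex d)) {k : ℕ} (hX_meas : Measurable (X k))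
    (hX_law : P.map (X k) =
      (volume.restrict (simplex d)).withDensity fun x => ENNReal.ofReal (f x))
    {h : (Fin d → ℝ) → ℝ} (hh : Measurable h) :
    ∫ ω, h (X k ω) ∂P = ∫ x in simplex d, h x * f x := by
  rw [← integral_map hX_meas.aemeasurable hh.aestronglyMeasurable, hX_law,
    integral_withDensity_eq_integral_toReal_smul₀
      (hf.aestronglyMeasurable measurableSet_simplex).aemeasurable.ennreal_ofReal
      (ae_of_all _ fun _ => ENNReal.ofReal_lt_top)]
  refine setIntegral_congr_fun measurableSet_simplex fun x hx => ?_
  rw [ENNReal.toReal_ofReal (hf_nonneg x hx), smul_eq_mul, mul_comm]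

theorem ae_mem_simplex_of_law {k : ℕ} (hX_meas : Measurable (X k))
    (hX_law : P.map (X k) =
      (volume.restrict (simplex d)).withDensity fun x => ENNReal.ofReal (f x)) :
    ∀ᵐ ω ∂P, X k ω ∈ simplex d := by
  refine ae_of_ae_map hX_meas.aemeasurable ?_
  rw [hX_law]
  exact (withDensity_absolutelyContinuous _ _).ae_le (ae_restrict_mem measurableSet_simplex)

theorem memLp_dirichletDensity_comp [IsProbabilityMeasure P]
    {k : ℕ} (hX_meas : Measurable (X k))
    (hX_law : P.map (X k) =
      (volume.restrict (simplex d)).withDensity fun x => ENNReal.ofReal (f x))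
    {s : Fin d → ℝ} (hs : s ∈ simplex d) {b : ℝ} (hb : 0 < b) :
    MemLp (fun ω => dirichletDensity (fun i => s i / b + 1) ((1 - l1 s) / b + 1) (X k ω)) 2 P := by
  have h1 : ∀ i, 1 ≤ s i / b + 1 := fun i => by
    have := div_nonneg (simplex_nonneg hs i) hb.le
    linarith
  have h2 : 1 ≤ (1 - l1 s) / b + 1 := by
    have := div_nonneg (sub_nonneg.2 (l1_le_one hs)) hb.le
    linarith
  refine MemLp.of_bound ((measurable_dirichletDensity _ _).comp hX_meas).aestronglyMeasurable
    (Real.Gamma (l1 (fun i => s i / b + 1) + ((1 - l1 s) / b + 1)) /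
      (Real.Gamma ((1 - l1 s) / b + 1) * ∏ i, Real.Gamma (s i / b + 1))) ?_
  filter_upwards [ae_mem_simplex_of_law hX_meas hX_law] with ω hω
  rw [Real.norm_eq_abs, abs_of_nonneg (dirichletDensity_nonneg (kernel_alpha_pos hs hb)
    (kernel_beta_pos hs hb) hω)]
  exact dirichletDensity_le h1 h2 hω

/-- The mean squared distance of an average of pairwise independent identically distributed
variables from a constant. -/
theorem integral_sq_average_sub [IsProbabilityMeasure P]
    {Y : ℕ → Ω → ℝ} (hY : ∀ k, MemLp (Y k) 2 P)
    (hind : Pairwise fun i j => Y i ⟂ᵢ[P] Y j) {m v : ℝ} (hm : ∀ k, ∫ ω, Y k ω ∂P = m)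
    (hv : ∀ k, ∫ ω, Y k ω ^ 2 ∂P = v) {n : ℕ} (hn : 1 ≤ n) (c : ℝ) :
    ∫ ω, (1 / (n : ℝ) * ∑ k ∈ Finset.range n, Y k ω - c) ^ 2 ∂P =
      (n : ℝ)⁻¹ * (v - m ^ 2) + (m - c) ^ 2 := by
  have hn0 : (n : ℝ) ≠ 0 := by positivity
  have hS : MemLp (fun ω => ∑ k ∈ Finset.range n, Y k ω) 2 P :=
    memLp_finsetSum _ fun k _ => hY k
  have hA : MemLp (fun ω => 1 / (n : ℝ) * ∑ k ∈ Finset.range n, Y k ω) 2 P := hS.const_mul _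
  have hvar : Var[fun ω => ∑ k ∈ Finset.range n, Y k ω; P] = n * (v - m ^ 2) := by
    have h1 := IndepFun.variance_sum (s := Finset.range n) (fun k _ => hY k)
      (fun i _ j _ hij => hind hij)
    have h2 : (∑ k ∈ Finset.range n, Y k) = fun ω => ∑ k ∈ Finset.range n, Y k ω := by
      ext ω; simp
    rw [h2] at h1
    rw [h1, Finset.sum_congr rfl fun k _ => variance_eq_sub (hY k)]
    simp only [Pi.pow_apply, hm, hv]
    simp
    ring
  have hmean : ∫ ω, (1 / (n : ℝ) * ∑ k ∈ Finset.range n, Y k ω) ∂P = m := by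
    rw [integral_const_mul, integral_finsetSum _ fun k _ => (hY k).integrable one_le_two]
    simp only [hm, Finset.sum_const, Finset.card_range, nsmul_eq_mul]
    field_simp
  -- The variance ignores the shift by c, so the second moment about c is the variance plus (m -
  -- c)².
  have h3 := variance_eq_sub (hA.sub (memLp_const c))
  have h4 : Var[(fun ω => 1 / (n : ℝ) * ∑ k ∈ Finset.range n, Y k ω) - fun _ => c; P] =
      (1 / (n : ℝ)) ^ 2 * (n * (v - m ^ 2)) := by
    rw [← hvar, ← variance_const_mul]
    exact variance_sub_const hA.aestronglyMeasurable c
  rw [h4] at h3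
  simp only [Pi.pow_apply, Pi.sub_apply] at h3
  rw [integral_sub (hA.integrable one_le_two) (integrable_const _), hmean] at h3
  simp only [integral_const, probReal_univ, one_smul] at h3
  have h5 : (1 / (n : ℝ)) ^ 2 * (n * (v - m ^ 2)) = (n : ℝ)⁻¹ * (v - m ^ 2) := by
    field_simp
  linarith

theorem integrable_sq_estimator_sub [IsProbabilityMeasure P]
    (hX_meas : ∀ k, Measurable (X k))
    (hX_law : ∀ k, P.map (X k) =
      (volume.restrict (simplex d)).withDensity fun x => ENNReal.ofReal (f x))
    (n : ℕ) {b : ℝ} (hb : 0 < b) {s : Fin d → ℝ} (hs : s ∈ simplex d) :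
    Integrable (fun ω => |estimator n b (fun k => X k ω) s - f s| ^ 2) P := by
  simp_rw [sq_abs]
  have h : MemLp (fun ω => estimator n b (fun k => X k ω) s) 2 P := by
    unfold estimator
    exact (memLp_finsetSum _ fun k _ =>
      memLp_dirichletDensity_comp (hX_meas k) (hX_law k) hs hb).const_mul _
  exact (h.sub (memLp_const (f s))).integrable_sq

theorem mse_eq [IsProbabilityMeasure P]
    (hf_nonneg : ∀ s ∈ simplex d, 0 ≤ f s)
    (hf : ContinuousOn f (simplex d)) (hX_meas : ∀ k, Measurable (X k)) (hX_indep : iIndepFun X P)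
    (hX_law : ∀ k, P.map (X k) =
      (volume.restrict (simplex d)).withDensity fun x => ENNReal.ofReal (f x))
    {n : ℕ} (hn : 1 ≤ n) {b : ℝ} (hb : 0 < b) {s : Fin d → ℝ} (hs : s ∈ simplex d) :
    mse P X f n b s = (n : ℝ)⁻¹ * (secondMoment f b s - (∫ x, f x ∂(kernelMeasure s b)) ^ 2) +
      (∫ x, f x ∂(kernelMeasure s b) - f s) ^ 2 := by
  have hD := measurable_dirichletDensity (fun i => s i / b + 1) ((1 - l1 s) / b + 1)
  unfold mse estimator
  simp_rw [sq_abs]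
  refine integral_sq_average_sub
    (fun k => memLp_dirichletDensity_comp (hX_meas k) (hX_law k) hs hb) ?_ ?_ ?_ hn _
  · intro i j hij
    exact (hX_indep.indepFun hij).comp hD hD
  · intro k
    rw [integral_comp_of_law hf_nonneg hf (hX_meas k) (hX_law k) hD, kernelMeasure,
      integral_dirichletMeasure (kernel_alpha_pos hs hb) (kernel_beta_pos hs hb)]
  · intro k
    exact integral_comp_of_law hf_nonneg hf (hX_meas k) (hX_law k) (hD.pow_const 2)

theorem integrableOn_mse [IsProbabilityMeasure P]
    (hf_nonneg : ∀ s ∈ simplex d, 0 ≤ f s)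
    (hf : ContinuousOn f (simplex d)) (hX_meas : ∀ k, Measurable (X k)) (hX_indep : iIndepFun X P)
    (hX_law : ∀ k, P.map (X k) =
      (volume.restrict (simplex d)).withDensity fun x => ENNReal.ofReal (f x))
    {n : ℕ} (hn : 1 ≤ n) {b : ℝ} (hb : 0 < b) :
    IntegrableOn (mse P X f n b) (simplex d) := by
  refine IntegrableOn.congr_fun ((((integrableOn_secondMoment hf hb).sub
    (integrableOn_sq_integral_kernelMeasure hf hb)).const_mul (n : ℝ)⁻¹).add
    (integrableOn_sq_bias hf hb)) (fun s hs => ?_) measurableSet_simplex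
  exact (mse_eq hf_nonneg hf hX_meas hX_indep hX_law hn hb hs).symm

theorem mise_eq [IsProbabilityMeasure P]
    (hf_nonneg : ∀ s ∈ simplex d, 0 ≤ f s)
    (hf : ContinuousOn f (simplex d)) (hX_meas : ∀ k, Measurable (X k)) (hX_indep : iIndepFun X P)
    (hX_law : ∀ k, P.map (X k) =
      (volume.restrict (simplex d)).withDensity fun x => ENNReal.ofReal (f x))
    {n : ℕ} (hn : 1 ≤ n) {b : ℝ} (hb : 0 < b) :
    mise P X f n b = (n : ℝ)⁻¹ * ((∫ s in simplex d, secondMoment f b s) -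
      ∫ s in simplex d, (∫ x, f x ∂(kernelMeasure s b)) ^ 2) +
      ∫ s in simplex d, (∫ x, f x ∂(kernelMeasure s b) - f s) ^ 2 := by
  have h1 := integrableOn_secondMoment hf hb
  have h2 := integrableOn_sq_integral_kernelMeasure hf hb
  have h3 : IntegrableOn (fun s => (n : ℝ)⁻¹ *
      (secondMoment f b s - (∫ x, f x ∂(kernelMeasure s b)) ^ 2)) (simplex d) :=
    (h1.sub h2).const_mul _
  rw [mise, setIntegral_congr_fun measurableSet_simplex fun s hs =>
    mse_eq hf_nonneg hf hX_meas hX_indep hX_law hn hb hs,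
    integral_add h3 (integrableOn_sq_bias hf hb), integral_const_mul, integral_sub h1 h2]

end Law

/-- ψ is positive off the null boundary, so a zero integral would make f vanish almost everywhere,
contradicting total mass one. -/
theorem integral_psi_mul_pos (hf_nonneg : ∀ s ∈ simplex d, 0 ≤ f s)
    (hf : ContinuousOn f (simplex d)) (hone : ∫ s in simplex d, f s = 1) :
    0 < ∫ s in simplex d, psi s * f s := by
  have h0 : 0 ≤ᵐ[volume.restrict (simplex d)] fun s => psi s * f s :=
    (ae_restrict_mem measurableSet_simplex).mono fun s hs => mul_nonneg (psi_nonneg hs)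
      (hf_nonneg s hs)
  refine (integral_nonneg_of_ae h0).lt_of_ne fun h => ?_
  rw [eq_comm, integral_eq_zero_iff_of_nonneg_ae h0 (integrableOn_psi_mul hf)] at h
  have h1 : f =ᵐ[volume.restrict (simplex d)] 0 := by
    filter_upwards [h, ae_simplex_pos] with s hs hpos
    exact (mul_eq_zero.1 hs).resolve_left (psi_pos hpos.2.1 hpos.2.2).ne'
  rw [integral_congr_ae h1] at hone
  simp at hone

end DirichletKernel

/-! ### Bandwidth selection from the expansion alone -/

namespace DirichletKernel

section Bandwidth

/-- `M` has the expansion `n⁻¹ b^{-d/2} A + b² B + o(n⁻¹ b^{-d/2}) + o(b²)`. -/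
def HasExpansion (d : ℕ) (A B : ℝ) (M : ℕ → ℝ → ℝ) : Prop :=
  ∃ R₁ R₂ : ℕ × ℝ → ℝ,
    R₁ =o[atTop ×ˢ 𝓝[>] (0 : ℝ)] (fun p => (p.1 : ℝ)⁻¹ * p.2 ^ (-((d : ℝ) / 2))) ∧
    R₂ =o[atTop ×ˢ 𝓝[>] (0 : ℝ)] (fun p => p.2 ^ 2) ∧
    ∀ (n : ℕ) (b : ℝ), 1 ≤ n → 0 < b →
      M n b = (n : ℝ)⁻¹ * b ^ (-((d : ℝ) / 2)) * A + b ^ 2 * B + R₁ (n, b) + R₂ (n, b)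

variable {d : ℕ} {A B : ℝ} {M : ℕ → ℝ → ℝ}

theorem IsBandwidth.tendsto {b : ℕ → ℝ} (hb : IsBandwidth b) :
    Tendsto (fun n => (n, b n)) atTop (atTop ×ˢ 𝓝[>] (0 : ℝ)) :=
  tendsto_id.prodMk (tendsto_nhdsWithin_iff.2 ⟨hb.2, hb.1⟩)

/-- Dividing each remainder by its scale turns the additive errors into vanishing perturbations of A
and B along the sequence. -/
theorem HasExpansion.exists_factors (h : HasExpansion d A B M) {b : ℕ → ℝ} (hb : IsBandwidth b) :
    ∃ r₁ r₂ : ℕ → ℝ, Tendsto r₁ atTop (𝓝 0) ∧ Tendsto r₂ atTop (𝓝 0) ∧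
      ∀ᶠ n in atTop, 1 ≤ n ∧ 0 < b n ∧ M n (b n) =
        (n : ℝ)⁻¹ * b n ^ (-((d : ℝ) / 2)) * (A + r₁ n) + b n ^ 2 * (B + r₂ n) := by
  obtain ⟨R₁, R₂, h₁, h₂, h⟩ := h
  refine ⟨_, _, (h₁.comp_tendsto hb.tendsto).tendsto_div_nhds_zero,
    (h₂.comp_tendsto hb.tendsto).tendsto_div_nhds_zero, ?_⟩
  filter_upwards [eventually_ge_atTop 1, hb.1] with n hn hbn
  refine ⟨hn, hbn, ?_⟩
  have : 0 < b n ^ (-((d : ℝ) / 2)) := Real.rpow_pos_of_pos hbn _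
  have : (n : ℝ) ≠ 0 := by positivity
  rw [h n _ hn hbn]
  simp only [Function.comp_apply]
  field_simp
  ring

/-- In the variable u = n^(2/(d+4)) b both terms carry the same power n^(-4/(d+4)); this fixes the
optimal rate. -/
theorem rpow_scaling {n : ℕ} (hn : 1 ≤ n) {b : ℝ} (hb : 0 < b) :
    (n : ℝ)⁻¹ * b ^ (-((d : ℝ) / 2)) = (n : ℝ) ^ (-(4 / ((d : ℝ) + 4))) *
      ((n : ℝ) ^ (2 / ((d : ℝ) + 4)) * b) ^ (-((d : ℝ) / 2)) ∧
    b ^ 2 = (n : ℝ) ^ (-(4 / ((d : ℝ) + 4))) * ((n : ℝ) ^ (2 / ((d : ℝ) + 4)) * b) ^ 2 := by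
  have hn0 : (0 : ℝ) < n := by positivity
  have hd : (d : ℝ) + 4 ≠ 0 := by positivity
  constructor
  · rw [Real.mul_rpow (by positivity) hb.le, ← Real.rpow_mul hn0.le, ← mul_assoc,
      ← Real.rpow_add hn0, ← Real.rpow_neg_one]
    congr 2
    field_simp
    ring
  · rw [mul_pow, ← mul_assoc, ← Real.rpow_natCast ((n : ℝ) ^ _), ← Real.rpow_mul hn0.le,
      ← Real.rpow_add hn0]
    have : -(4 / ((d : ℝ) + 4)) + 2 / ((d : ℝ) + 4) * (2 : ℕ) = 0 := by
      push_cast; field_simp; ring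
    rw [this, Real.rpow_zero, one_mul]

theorem tendsto_natCast_rpow_neg {p : ℝ} (hp : 0 < p) :
    Tendsto (fun n : ℕ => (n : ℝ) ^ (-p)) atTop (𝓝 0) :=
  (tendsto_rpow_neg_atTop hp).comp tendsto_natCast_atTop_atTop

theorem isBandwidth_of_tendsto {b : ℕ → ℝ} {lam : ℝ} (hlam : 0 < lam)
    (h : Tendsto (fun n : ℕ => (n : ℝ) ^ (2 / ((d : ℝ) + 4)) * b n) atTop (𝓝 lam)) :
    IsBandwidth b := by
  constructor
  · filter_upwards [h.eventually (eventually_gt_nhds hlam)] with n hn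
    exact pos_of_mul_pos_right hn (by positivity)
  · have h1 := (tendsto_natCast_rpow_neg (by positivity : 0 < 2 / ((d : ℝ) + 4))).mul h
    rw [zero_mul] at h1
    refine h1.congr' ?_
    filter_upwards [eventually_ge_atTop 1] with n hn
    have hn0 : (0 : ℝ) < n := by positivity
    rw [← mul_assoc, ← Real.rpow_add hn0, neg_add_cancel, Real.rpow_zero, one_mul]

theorem HasExpansion.isLittleO_of_tendsto (h : HasExpansion d A B M) {b : ℕ → ℝ} {lam : ℝ}
    (hlam : 0 < lam)
    (hb : Tendsto (fun n : ℕ => (n : ℝ) ^ (2 / ((d : ℝ) + 4)) * b n) atTop (𝓝 lam)) :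
    (fun n : ℕ => M n (b n) -
      (n : ℝ) ^ (-(4 / ((d : ℝ) + 4))) * (lam ^ (-((d : ℝ) / 2)) * A + lam ^ 2 * B))
      =o[atTop] (fun n : ℕ => (n : ℝ) ^ (-(4 / ((d : ℝ) + 4)))) := by
  obtain ⟨r₁, r₂, h₁, h₂, hM⟩ := h.exists_factors (isBandwidth_of_tendsto hlam hb)
  have hlim := ((hb.rpow_const (p := -((d : ℝ) / 2)) (Or.inl hlam.ne')).mul
    (h₁.const_add A)).add ((hb.pow 2).mul (h₂.const_add B))
  rw [add_zero, add_zero, ← tendsto_sub_nhds_zero_iff] at hlim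
  refine (isLittleO_iff_tendsto' ?_).2 (hlim.congr' ?_)
  · filter_upwards [eventually_ge_atTop 1] with n hn h0
    have hn0 : (0 : ℝ) < n := by positivity
    exact absurd h0 (Real.rpow_pos_of_pos hn0 _).ne'
  · filter_upwards [hM] with n ⟨hn, hbn, hMn⟩
    have hn0 : (0 : ℝ) < n := by positivity
    have := Real.rpow_pos_of_pos hn0 (-(4 / ((d : ℝ) + 4)))
    rw [hMn, (rpow_scaling hn hbn).1, (rpow_scaling (d := d) hn hbn).2]
    field_simp

/-- In w = log t the right side is (2/k)e^(-kw) + e^(2w), whose linear terms cancel. The exponential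
with nonnegative exponent supplies the quadratic term, 2w² for w ≥ 0 and kw² for w ≤ 0; the other is
bounded by its tangent. -/
theorem quadratic_growth {k t : ℝ} (hk : 0 < k) (ht : 0 < t) :
    2 / k + 1 + min 2 k * Real.log t ^ 2 ≤ 2 / k * t ^ (-k) + t ^ 2 := by
  set w := Real.log t with hw
  have h1 : t ^ (-k) = Real.exp (-(k * w)) := by
    rw [Real.rpow_def_of_pos ht, ← hw]; ring_nf
  have h2 : t ^ 2 = Real.exp (2 * w) := by
    rw [mul_comm, Real.exp_mul, hw, Real.exp_log ht, ← Real.rpow_natCast]; norm_num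
  rw [h1, h2]
  have e1 := Real.add_one_le_exp (-(k * w))
  have e2 := Real.add_one_le_exp (2 * w)
  rcases le_total 0 w with h | h
  · have e3 := Real.quadratic_le_exp_of_nonneg (by positivity : 0 ≤ 2 * w)
    have e4 : 2 / k * (-(k * w) + 1) ≤ 2 / k * Real.exp (-(k * w)) := by gcongr
    have e5 : 2 / k * (-(k * w) + 1) = 2 / k - 2 * w := by field_simp; ring
    have e6 : min 2 k * w ^ 2 ≤ 2 * w ^ 2 := by gcongr; exact min_le_left _ _
    nlinarith
  · have e3 := Real.quadratic_le_exp_of_nonneg (by nlinarith : 0 ≤ -(k * w))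
    have e4 : 2 / k * (1 + -(k * w) + (-(k * w)) ^ 2 / 2) ≤ 2 / k * Real.exp (-(k * w)) := by
      gcongr
    have e5 : 2 / k * (1 + -(k * w) + (-(k * w)) ^ 2 / 2) = 2 / k - 2 * w + k * w ^ 2 := by
      field_simp
      ring
    have e6 : min 2 k * w ^ 2 ≤ k * w ^ 2 := by gcongr; exact min_le_right _ _
    linarith

theorem optBandwidth_pos (hd : 1 ≤ d) (hA : 0 < A) (hB : 0 < B) {n : ℕ} (hn : 1 ≤ n) :
    0 < optBandwidth d A B n := by
  have hn0 : (0 : ℝ) < n := by positivity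
  have hd0 : (0 : ℝ) < d := by positivity
  unfold optBandwidth
  positivity

theorem rpow_mul_optBandwidth {n : ℕ} (hn : 1 ≤ n) :
    (n : ℝ) ^ (2 / ((d : ℝ) + 4)) * optBandwidth d A B n =
      ((d : ℝ) / 4 * (A / B)) ^ (2 / ((d : ℝ) + 4)) := by
  have hn0 : (0 : ℝ) < n := by positivity
  rw [optBandwidth, ← mul_assoc, ← Real.rpow_add hn0, add_neg_cancel, Real.rpow_zero, one_mul]

/-- Balance of the two terms of the leading part. -/
theorem rpow_balance (hd : 1 ≤ d) (hA : 0 < A) (hB : 0 < B) :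
    (((d : ℝ) / 4 * (A / B)) ^ (2 / ((d : ℝ) + 4))) ^ (-((d : ℝ) / 2)) * A =
      4 / d * ((((d : ℝ) / 4 * (A / B)) ^ (2 / ((d : ℝ) + 4))) ^ 2 * B) := by
  have hd0 : (0 : ℝ) < d := by positivity
  set c := (d : ℝ) / 4 * (A / B) with hc
  have hc0 : 0 < c := by positivity
  have hAc : A = c * (4 / d * B) := by rw [hc]; field_simp
  have h1 : (c ^ (2 / ((d : ℝ) + 4))) ^ (-((d : ℝ) / 2)) * c = (c ^ (2 / ((d : ℝ) + 4))) ^ 2 := by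
    rw [← Real.rpow_natCast (c ^ (2 / ((d : ℝ) + 4))), ← Real.rpow_mul hc0.le,
      ← Real.rpow_mul hc0.le, ← Real.rpow_add_one hc0.ne']
    congr 1
    push_cast
    field_simp
    ring
  calc _ = (c ^ (2 / ((d : ℝ) + 4))) ^ (-((d : ℝ) / 2)) * (c * (4 / d * B)) := by rw [← hAc]
    _ = (c ^ (2 / ((d : ℝ) + 4))) ^ (-((d : ℝ) / 2)) * c * (4 / d * B) := by ring
    _ = _ := by rw [h1]; ring

/-- At the optimum the variance term is 4/d times the squared-bias term, so in units of b_opt the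
leading part is the function of `quadratic_growth` with k = d/2. -/
theorem leading_mul_optBandwidth (hd : 1 ≤ d) (hA : 0 < A) (hB : 0 < B) {n : ℕ} (hn : 1 ≤ n)
    {t : ℝ} (ht : 0 < t) :
    leading d A B n (t * optBandwidth d A B n) = optBandwidth d A B n ^ 2 * B *
      (2 / ((d : ℝ) / 2) * t ^ (-((d : ℝ) / 2)) + t ^ 2) := by
  have hβ := optBandwidth_pos hd hA hB hn
  have hd0 : (0 : ℝ) < d := by positivity
  have h1 : (n : ℝ)⁻¹ * optBandwidth d A B n ^ (-((d : ℝ) / 2)) * A =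
      4 / d * (optBandwidth d A B n ^ 2 * B) := by
    rw [(rpow_scaling hn hβ).1, (rpow_scaling (d := d) hn hβ).2, rpow_mul_optBandwidth hn,
      mul_assoc, rpow_balance hd hA hB]
    ring
  rw [leading, Real.mul_rpow ht.le hβ.le]
  calc _ = t ^ (-((d : ℝ) / 2)) * ((n : ℝ)⁻¹ * optBandwidth d A B n ^ (-((d : ℝ) / 2)) * A) +
        t ^ 2 * optBandwidth d A B n ^ 2 * B := by ring
    _ = _ := by
      rw [h1]
      field_simp
      ring

theorem leading_optBandwidth (hd : 1 ≤ d) (hA : 0 < A) (hB : 0 < B) {n : ℕ} (hn : 1 ≤ n) :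
    leading d A B n (optBandwidth d A B n) = optBandwidth d A B n ^ 2 * B *
      (2 / ((d : ℝ) / 2) + 1) := by
  simpa using leading_mul_optBandwidth hd hA hB hn one_pos

theorem leading_growth (hd : 1 ≤ d) (hA : 0 < A) (hB : 0 < B) {n : ℕ} (hn : 1 ≤ n) {b : ℝ}
    (hb : 0 < b) :
    leading d A B n (optBandwidth d A B n) + optBandwidth d A B n ^ 2 * B *
      (min 2 ((d : ℝ) / 2) * Real.log (b / optBandwidth d A B n) ^ 2) ≤ leading d A B n b := by
  have hβ := optBandwidth_pos hd hA hB hn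
  have hd0 : (0 : ℝ) < d := by positivity
  have h1 := leading_mul_optBandwidth hd hA hB hn (div_pos hb hβ)
  rw [div_mul_cancel₀ _ hβ.ne'] at h1
  rw [h1, leading_optBandwidth hd hA hB hn, ← mul_add]
  exact mul_le_mul_of_nonneg_left (quadratic_growth (by positivity) (div_pos hb hβ))
    (by positivity)

theorem leading_optBandwidth_lt (hd : 1 ≤ d) (hA : 0 < A) (hB : 0 < B) {n : ℕ} (hn : 1 ≤ n) {b : ℝ}
    (hb : 0 < b) (hne : b ≠ optBandwidth d A B n) :
    leading d A B n (optBandwidth d A B n) < leading d A B n b := by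
  have hβ := optBandwidth_pos hd hA hB hn
  have hd0 : (0 : ℝ) < d := by positivity
  refine lt_of_lt_of_le (lt_add_of_pos_right _ ?_) (leading_growth hd hA hB hn hb)
  have h1 : Real.log (b / optBandwidth d A B n) ≠ 0 :=
    Real.log_ne_zero_of_pos_of_ne_one (div_pos hb hβ)
      fun h => hne ((div_eq_one_iff_eq hβ.ne').1 h)
  positivity

theorem leading_optBandwidth_le (hd : 1 ≤ d) (hA : 0 < A) (hB : 0 < B) {n : ℕ} (hn : 1 ≤ n) {b : ℝ}
    (hb : 0 < b) : leading d A B n (optBandwidth d A B n) ≤ leading d A B n b := by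
  rcases eq_or_ne b (optBandwidth d A B n) with h | h
  · rw [h]
  · exact (leading_optBandwidth_lt hd hA hB hn hb h).le

theorem leading_pos (hA : 0 < A) (hB : 0 < B) {n : ℕ} {b : ℝ} (hb : 0 < b) :
    0 < leading d A B n b := by
  have := Real.rpow_pos_of_pos hb (-((d : ℝ) / 2))
  unfold leading
  positivity

theorem tendsto_rpow_mul_optBandwidth :
    Tendsto (fun n : ℕ => (n : ℝ) ^ (2 / ((d : ℝ) + 4)) * optBandwidth d A B n) atTop
      (𝓝 (((d : ℝ) / 4 * (A / B)) ^ (2 / ((d : ℝ) + 4)))) := by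
  refine tendsto_const_nhds.congr' ?_
  filter_upwards [eventually_ge_atTop 1] with n hn
  rw [rpow_mul_optBandwidth hn]

theorem optConst_pos (hd : 1 ≤ d) (hA : 0 < A) (hB : 0 < B) :
    0 < ((d : ℝ) / 4 * (A / B)) ^ (2 / ((d : ℝ) + 4)) := by
  have hd0 : (0 : ℝ) < d := by positivity
  positivity

theorem isBandwidth_optBandwidth (hd : 1 ≤ d) (hA : 0 < A) (hB : 0 < B) :
    IsBandwidth (optBandwidth d A B) :=
  isBandwidth_of_tendsto (optConst_pos hd hA hB) tendsto_rpow_mul_optBandwidth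

/-- Both leading terms are positive, so the relative error is at most |r₁|/A + |r₂|/B whatever their
relative sizes; the speed of the bandwidth is irrelevant. -/
theorem HasExpansion.tendsto_div_leading (h : HasExpansion d A B M) (hA : 0 < A) (hB : 0 < B)
    {b : ℕ → ℝ} (hb : IsBandwidth b) :
    Tendsto (fun n => M n (b n) / leading d A B n (b n)) atTop (𝓝 1) := by
  obtain ⟨r₁, r₂, h₁, h₂, hM⟩ := h.exists_factors hb
  have hlim : Tendsto (fun n => |r₁ n| / A + |r₂ n| / B) atTop (𝓝 0) := by
    simpa using (h₁.abs.div_const A).add (h₂.abs.div_const B)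
  rw [← tendsto_sub_nhds_zero_iff]
  refine squeeze_zero_norm' ?_ hlim
  filter_upwards [hM] with n ⟨hn, hbn, hMn⟩
  have hL := leading_pos (d := d) hA hB (n := n) hbn
  have hn0 : (0 : ℝ) < n := by positivity
  have hp : 0 < (n : ℝ)⁻¹ * b n ^ (-((d : ℝ) / 2)) :=
    mul_pos (by positivity) (Real.rpow_pos_of_pos hbn _)
  rw [div_sub_one hL.ne', hMn, Real.norm_eq_abs, abs_div, abs_of_pos hL, div_le_iff₀ hL]
  rw [leading] at hL ⊢
  set p := (n : ℝ)⁻¹ * b n ^ (-((d : ℝ) / 2))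
  have hq : 0 < b n ^ 2 := by positivity
  set q := b n ^ 2
  have e1 : p * (A + r₁ n) + q * (B + r₂ n) - (p * A + q * B) = p * r₁ n + q * r₂ n := by ring
  rw [e1]
  have e2 : |p * r₁ n + q * r₂ n| ≤ p * |r₁ n| + q * |r₂ n| := by
    refine (abs_add_le _ _).trans ?_
    rw [abs_mul p, abs_mul q, abs_of_pos hp, abs_of_pos hq]
  refine e2.trans ?_
  have e3 : (|r₁ n| / A + |r₂ n| / B) * (p * A + q * B) =
      p * |r₁ n| + q * |r₂ n| + (|r₁ n| / A * (q * B) + |r₂ n| / B * (p * A)) := by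
    field_simp
    ring
  rw [e3]
  have : 0 ≤ |r₁ n| / A * (q * B) + |r₂ n| / B * (p * A) := by positivity
  linarith

theorem HasExpansion.isEquivalent_leading (h : HasExpansion d A B M) (hA : 0 < A) (hB : 0 < B)
    {b : ℕ → ℝ} (hb : IsBandwidth b) :
    (fun n => M n (b n)) ~[atTop] fun n => leading d A B n (b n) := by
  refine (isEquivalent_iff_tendsto_one ?_).2 (h.tendsto_div_leading hA hB hb)
  filter_upwards [hb.1] with n hn using (leading_pos hA hB hn).ne'

theorem HasExpansion.isAsymptoticallyOptimal (h : HasExpansion d A B M) (hd : 1 ≤ d) (hA : 0 < A)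
    (hB : 0 < B) : IsAsymptoticallyOptimal M (optBandwidth d A B) := by
  have hβ := isBandwidth_optBandwidth hd hA hB
  have hd0 : (0 : ℝ) < d := by positivity
  refine ⟨hβ, fun b hb => ⟨fun ε hε => ?_, fun hMM => ?_⟩⟩
  -- Chosen so that 1 + η = (1 + ε)(1 - η).
  · set η := ε / (2 + ε) with hη
    have hη0 : 0 < η := by positivity
    filter_upwards [(h.tendsto_div_leading hA hB hβ).eventually (eventually_le_nhds
        (by linarith : 1 < 1 + η)), (h.tendsto_div_leading hA hB hb).eventually
        (eventually_ge_nhds (by linarith : 1 - η < 1)), hβ.1, hb.1, eventually_ge_atTop 1]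
      with n h1 h2 hβn hbn hn
    rw [div_le_iff₀ (leading_pos hA hB hβn)] at h1
    rw [le_div_iff₀ (leading_pos hA hB hbn)] at h2
    calc M n (optBandwidth d A B n) ≤ (1 + η) * leading d A B n (optBandwidth d A B n) := h1
      _ ≤ (1 + η) * leading d A B n (b n) := by
        gcongr
        exact leading_optBandwidth_le hd hA hB hn hbn
      _ = (1 + ε) * ((1 - η) * leading d A B n (b n)) := by
        rw [hη]
        field_simp
        ring
      _ ≤ _ := by gcongr
  · have hL := ((h.isEquivalent_leading hA hB hb).symm.trans hMM).trans
      (h.isEquivalent_leading hA hB hβ)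
    have hβ0 : ∀ᶠ n in atTop, leading d A B n (optBandwidth d A B n) ≠ 0 := by
      filter_upwards [hβ.1] with n hn using (leading_pos hA hB hn).ne'
    have hL1 := (isEquivalent_iff_tendsto_one hβ0).1 hL
    set κ := min 2 ((d : ℝ) / 2) with hκ
    have hκ0 : 0 < κ := lt_min (by norm_num) (by positivity)
    set K := 2 / ((d : ℝ) / 2) + 1 with hK
    have hK0 : 0 < K := by positivity
    -- The growth estimate bounds log² of the bandwidth ratio by K/κ times the relative excess of
    -- the leading part, which tends to 0.
    have hsq : Tendsto (fun n => Real.log (b n / optBandwidth d A B n) ^ 2) atTop (𝓝 0) := by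
      have hlim : Tendsto (fun n => (K / κ) * (leading d A B n (b n) /
          leading d A B n (optBandwidth d A B n) - 1)) atTop (𝓝 0) := by
        simpa using ((hL1.sub_const 1).const_mul (K / κ))
      refine squeeze_zero' (Eventually.of_forall fun n => sq_nonneg _) ?_ hlim
      filter_upwards [hβ.1, hb.1, eventually_ge_atTop 1] with n hβn hbn hn
      have h1 := leading_growth hd hA hB hn hbn
      have h2 := leading_pos (d := d) hA hB (n := n) hβn
      rw [div_sub_one h2.ne', leading_optBandwidth hd hA hB hn]
      rw [leading_optBandwidth hd hA hB hn] at h1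
      rw [← hK] at h1 ⊢
      rw [div_mul_div_comm, le_div_iff₀ (by positivity)]
      nlinarith
    have hlog : Tendsto (fun n => Real.log (b n / optBandwidth d A B n)) atTop (𝓝 0) := by
      have := hsq.sqrt
      simp_rw [Real.sqrt_sq_eq_abs, Real.sqrt_zero] at this
      exact (tendsto_zero_iff_abs_tendsto_zero _).2 this
    have hexp := (Real.continuous_exp.tendsto 0).comp hlog
    rw [Real.exp_zero] at hexp
    refine (isEquivalent_iff_tendsto_one ?_).2 (hexp.congr' ?_)
    · filter_upwards [hβ.1] with n hn using hn.ne'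
    · filter_upwards [hβ.1, hb.1] with n hβn hbn
      exact Real.exp_log (div_pos hbn hβn)

/-- By `rpow_balance` the sum is 4/d + 1 times the squared-bias term; with q = 4/(d+4) and d/(d+4) =
1 - q the rest is algebra of q-th powers. -/
theorem opt_value (hd : 1 ≤ d) (hA : 0 < A) (hB : 0 < B) :
    (((d : ℝ) / 4 * (A / B)) ^ (2 / ((d : ℝ) + 4))) ^ (-((d : ℝ) / 2)) * A +
      (((d : ℝ) / 4 * (A / B)) ^ (2 / ((d : ℝ) + 4))) ^ 2 * B =
    ((1 + (d : ℝ) / 4) / ((d : ℝ) / 4) ^ ((d : ℝ) / ((d : ℝ) + 4))) *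
      (A ^ (4 / ((d : ℝ) + 4)) / B ^ (-((d : ℝ) / ((d : ℝ) + 4)))) := by
  have hd0 : (0 : ℝ) < d := by positivity
  rw [rpow_balance hd hA hB]
  set q := 4 / ((d : ℝ) + 4) with hq
  have h1 : (d : ℝ) / ((d : ℝ) + 4) = 1 - q := by rw [hq]; field_simp; ring
  have h2 : (((d : ℝ) / 4 * (A / B)) ^ (2 / ((d : ℝ) + 4))) ^ 2 =
      ((d : ℝ) / 4) ^ q * (A ^ q / B ^ q) := by
    rw [← Real.rpow_natCast, ← Real.rpow_mul (by positivity), ← Real.div_rpow hA.le hB.le,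
      ← Real.mul_rpow (by positivity) (by positivity), hq]
    congr 1
    push_cast
    ring
  rw [h1, h2, Real.rpow_neg hB.le, Real.rpow_sub hB, Real.rpow_sub (by positivity), Real.rpow_one,
    Real.rpow_one]
  have := Real.rpow_pos_of_pos hA q
  have := Real.rpow_pos_of_pos hB q
  have := Real.rpow_pos_of_pos (by positivity : 0 < (d : ℝ) / 4) q
  generalize ((d : ℝ) / 4) ^ q = x at *
  field_simp

end Bandwidth

end DirichletKernel

/-! ### The expansion of the error and the theorem -/

namespace DirichletKernel

variable {d : ℕ} {f : (Fin d → ℝ) → ℝ}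

theorem rpow_neg_half_mul_sqrt_pow {b : ℝ} (hb : 0 < b) :
    b ^ (-((d : ℝ) / 2)) * √b ^ d = 1 := by
  rw [Real.sqrt_eq_rpow, ← Real.rpow_natCast, ← Real.rpow_mul hb.le, ← Real.rpow_add hb,
    show -((d : ℝ) / 2) + 1 / 2 * (d : ℝ) = 0 by ring, Real.rpow_zero]

/-- The squared mean is bounded uniformly in b, so the vanishing factor b^(d/2) decides; this is
where d ≥ 1 enters. -/
theorem tendsto_sqrt_pow_mul_integral_sq (hd : 1 ≤ d) (hf : ContinuousOn f (simplex d)) :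
    Tendsto (fun b => √b ^ d * ∫ s in simplex d, (∫ x, f x ∂(kernelMeasure s b)) ^ 2) (𝓝[>] 0)
      (𝓝 0) := by
  obtain ⟨C, hC0, hC⟩ := exists_bound_of_continuousOn hf
  have h1 : Tendsto (fun b : ℝ => √b ^ d) (𝓝[>] 0) (𝓝 0) := by
    have : Tendsto (fun b : ℝ => √b ^ d) (𝓝 0) (𝓝 (√0 ^ d)) :=
      (Real.continuous_sqrt.pow d).tendsto 0
    rw [Real.sqrt_zero, zero_pow (by lia)] at this
    exact this.mono_left nhdsWithin_le_nhds
  have h2 := h1.mul_const (C ^ 2 * volume.real (simplex d))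
  rw [zero_mul] at h2
  refine squeeze_zero_norm' ?_ h2
  filter_upwards [self_mem_nhdsWithin] with b hb
  rw [norm_mul, norm_pow, Real.norm_eq_abs, abs_of_nonneg (Real.sqrt_nonneg b)]
  gcongr
  refine norm_setIntegral_le_of_norm_le_const volume_simplex_lt_top fun s hs => ?_
  rw [norm_pow]
  gcongr
  exact abs_integral_kernelMeasure_le hs hb hC

/-- The remainders are the exact differences of the two parts from their leading terms. Divided by
their scales they depend on b alone, hence are small in the product filter. -/
theorem hasExpansion_mise (hd : 1 ≤ d) {Ω : Type*} [MeasurableSpace Ω] {P : Measure Ω}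
    [IsProbabilityMeasure P] {X : ℕ → Ω → Fin d → ℝ}
    (hf_nonneg : ∀ s ∈ simplex d, 0 ≤ f s) (hf : ContDiffOn ℝ 2 f (simplex d))
    (hX_meas : ∀ k, Measurable (X k)) (hX_indep : iIndepFun X P)
    (hX_law : ∀ k, P.map (X k) =
      (volume.restrict (simplex d)).withDensity fun x => ENNReal.ofReal (f x)) :
    HasExpansion d (∫ s in simplex d, psi s * f s) (∫ s in simplex d, biasCoeff f s ^ 2)
      (mise P X f) := by
  set A := ∫ s in simplex d, psi s * f s with hA
  set B := ∫ s in simplex d, biasCoeff f s ^ 2 with hB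
  set V : ℝ → ℝ := fun b => ∫ s in simplex d, secondMoment f b s with hV
  set W : ℝ → ℝ := fun b => ∫ s in simplex d, (∫ x, f x ∂(kernelMeasure s b)) ^ 2 with hW
  set U : ℝ → ℝ := fun b => ∫ s in simplex d, (∫ x, f x ∂(kernelMeasure s b) - f s) ^ 2 with hU
  have hb : ∀ᶠ p : ℕ × ℝ in atTop ×ˢ 𝓝[>] (0 : ℝ), 0 < p.2 :=
    tendsto_snd.eventually self_mem_nhdsWithin
  refine ⟨fun p => (p.1 : ℝ)⁻¹ * (V p.2 - W p.2) - (p.1 : ℝ)⁻¹ * p.2 ^ (-((d : ℝ) / 2)) * A,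
    fun p => U p.2 - p.2 ^ 2 * B, ?_, ?_, fun n b hn hb => ?_⟩
  · rw [isLittleO_iff_exists_eq_mul]
    refine ⟨fun p => √p.2 ^ d * V p.2 - √p.2 ^ d * W p.2 - A, ?_, ?_⟩
    · have h := ((tendsto_integral_secondMoment hf).sub
        (tendsto_sqrt_pow_mul_integral_sq hd hf.continuousOn)).sub_const A
      rw [sub_zero, ← hA, sub_self] at h
      exact h.comp tendsto_snd
    · filter_upwards [hb] with p hp
      have h := rpow_neg_half_mul_sqrt_pow (d := d) hp
      simp only [Pi.mul_apply]
      linear_combination (-(p.1 : ℝ)⁻¹ * (V p.2 - W p.2)) * h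
  · rw [isLittleO_iff_exists_eq_mul]
    refine ⟨fun p => U p.2 / p.2 ^ 2 - B, ?_, ?_⟩
    · have h := (tendsto_integral_sq_bias hf).sub_const B
      rw [← hB, sub_self] at h
      exact h.comp tendsto_snd
    · filter_upwards [hb] with p hp
      simp only [Pi.mul_apply]
      field_simp
  · rw [mise_eq hf_nonneg hf.continuousOn hX_meas hX_indep hX_law hn hb]
    simp only [hV, hW, hU]
    ring

end DirichletKernel

theorem mainTheorem3 {d : ℕ} (hd : 1 ≤ d)
    {Ω : Type*} [MeasurableSpace Ω] (P : Measure Ω) [IsProbabilityMeasure P]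
    (f : (Fin d → ℝ) → ℝ)
    (hf_nonneg : ∀ s ∈ DirichletKernel.simplex d, 0 ≤ f s)
    (hf : ContDiffOn ℝ 2 f (DirichletKernel.simplex d))
    (X : ℕ → Ω → Fin d → ℝ)
    (hX_meas : ∀ k, Measurable (X k))
    (hX_indep : iIndepFun X P)
    (hX_law : ∀ k, P.map (X k) =
      (volume.restrict (DirichletKernel.simplex d)).withDensity
        (fun x => ENNReal.ofReal (f x)))
    (A B : ℝ)
    (hA : A = ∫ s in DirichletKernel.simplex d, DirichletKernel.psi s * f s)
    (hB : B = ∫ s in DirichletKernel.simplex d, DirichletKernel.biasCoeff f s ^ 2) :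
    -- all the integrals involved converge
    IntegrableOn (fun s => DirichletKernel.psi s * f s) (DirichletKernel.simplex d) ∧
    IntegrableOn (fun s => DirichletKernel.biasCoeff f s ^ 2) (DirichletKernel.simplex d) ∧
    (∀ (n : ℕ) (b : ℝ), 1 ≤ n → 0 < b →
      (∀ s ∈ DirichletKernel.simplex d,
        Integrable (fun ω => |DirichletKernel.estimator n b (fun k => X k ω) s - f s| ^ 2) P) ∧
      IntegrableOn (DirichletKernel.mse P X f n b) (DirichletKernel.simplex d)) ∧
    -- the expansion as `n → ∞` and `b → 0`
    (∃ R₁ R₂ : ℕ × ℝ → ℝ,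
      R₁ =o[atTop ×ˢ 𝓝[>] (0 : ℝ)]
        (fun p => (p.1 : ℝ)⁻¹ * p.2 ^ (-((d : ℝ) / 2))) ∧
      R₂ =o[atTop ×ˢ 𝓝[>] (0 : ℝ)] (fun p => p.2 ^ 2) ∧
      ∀ (n : ℕ) (b : ℝ), 1 ≤ n → 0 < b →
        DirichletKernel.mise P X f n b =
          (n : ℝ)⁻¹ * b ^ (-((d : ℝ) / 2)) * A + b ^ 2 * B + R₁ (n, b) + R₂ (n, b)) ∧
    -- the optimal bandwidth and the optimal error
    (0 < B →
      (∀ n : ℕ, 1 ≤ n → 0 < DirichletKernel.optBandwidth d A B n ∧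
        ∀ b : ℝ, 0 < b → b ≠ DirichletKernel.optBandwidth d A B n →
          DirichletKernel.leading d A B n (DirichletKernel.optBandwidth d A B n) <
            DirichletKernel.leading d A B n b) ∧
      DirichletKernel.IsAsymptoticallyOptimal (DirichletKernel.mise P X f)
        (DirichletKernel.optBandwidth d A B) ∧
      (fun n : ℕ => DirichletKernel.mise P X f n (DirichletKernel.optBandwidth d A B n) -
          (n : ℝ) ^ (-(4 / ((d : ℝ) + 4))) *
            ((1 + (d : ℝ) / 4) / ((d : ℝ) / 4) ^ ((d : ℝ) / ((d : ℝ) + 4))) *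
            (A ^ (4 / ((d : ℝ) + 4)) / B ^ (-((d : ℝ) / ((d : ℝ) + 4)))))
        =o[atTop] (fun n : ℕ => (n : ℝ) ^ (-(4 / ((d : ℝ) + 4))))) ∧
    -- bandwidths of the optimal order
    (∀ (b : ℕ → ℝ) (lam : ℝ), 0 < lam →
      Tendsto (fun n : ℕ => (n : ℝ) ^ (2 / ((d : ℝ) + 4)) * b n) atTop (𝓝 lam) →
      (fun n : ℕ => DirichletKernel.mise P X f n (b n) -
          (n : ℝ) ^ (-(4 / ((d : ℝ) + 4))) * (lam ^ (-((d : ℝ) / 2)) * A + lam ^ 2 * B))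
        =o[atTop] (fun n : ℕ => (n : ℝ) ^ (-(4 / ((d : ℝ) + 4))))) := by

  have hexp := DirichletKernel.hasExpansion_mise hd hf_nonneg hf hX_meas hX_indep hX_law
  rw [← hA, ← hB] at hexp
  have hcont := hf.continuousOn
  have hA0 : 0 < A := hA ▸ DirichletKernel.integral_psi_mul_pos hf_nonneg hcont
    (DirichletKernel.integral_density_eq_one hf_nonneg hcont (hX_meas 0) (hX_law 0))
  refine ⟨DirichletKernel.integrableOn_psi_mul hcont,
    DirichletKernel.integrableOn_sq_biasCoeff hf, fun n b hn hb =>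
      ⟨fun s hs => DirichletKernel.integrable_sq_estimator_sub hX_meas hX_law n hb hs,
        DirichletKernel.integrableOn_mse hf_nonneg hcont hX_meas hX_indep hX_law hn hb⟩,
    hexp, fun hB0 => ⟨fun n hn => ⟨DirichletKernel.optBandwidth_pos hd hA0 hB0 hn,
      fun b hb hne => DirichletKernel.leading_optBandwidth_lt hd hA0 hB0 hn hb hne⟩,
      hexp.isAsymptoticallyOptimal hd hA0 hB0, ?_⟩,
    fun b lam hlam hb => hexp.isLittleO_of_tendsto hlam hb⟩
  -- Along b_opt the rescaled bandwidth is constant for n ≥ 1, so (c) applies with λ equal to that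
  -- constant.
  have h := hexp.isLittleO_of_tendsto (DirichletKernel.optConst_pos hd hA0 hB0)
    DirichletKernel.tendsto_rpow_mul_optBandwidth
  rw [DirichletKernel.opt_value hd hA0 hB0] at h
  simpa only [mul_assoc] using h
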